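/- A \emph{3-polytope} is the convex hull of finitely many points of $\mathbb{R}^3$ that affinely span $\mathbb{R}^3$; two 3-polytopes are \emph{combinatorially equivalent} if their face lattices are isomorphic. A \emph{Koebe realization} of a 3-polytope $P$ is a 3-polytope $Q\subset\mathbb{R}^3$ that is combinatorially equivalent to $P$ and all of whose edges are tangent to the unit sphere $\mathbb{S}^2$ (that is, for every edge $e$ of $Q$ the line spanned by $e$ meets $\mathbb{S}^2$ in exactly one point, and this point lies on $e$). Let $\mathbb{Q}[Q]\subseteq\mathbb{R}$ be the field generated over $\mathbb{Q}$ by the coordinates of the vertices of $Q$. The \emph{Koebe degree} $\kappa(P)$ is the minimum of the degrees $[\mathbb{Q}[Q]:\mathbb{Q}]$ over all Koebe realizations $Q$ of $P$; it depends only on the combinatorial type of $P$. Let $B_k$ be (the combinatorial type of) the bipyramid over a $k$-gon, and let $\phi$ be Euler's totient function. \textbf{Theorem.} Let $k\ge 4$ be an integer. Then the Koebe degree $\kappa(B_k)$ is finite and \[ \kappa(B_k)\ \ge\ \frac{\phi(k)}{4}. \] In particular, the (finite) Koebe degree of a 3-polytope is not bounded by any constant: for every $C\in\mathbb{N}$ there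 is a 3-polytope $P$ with $C<\kappa(P)<\infty$. -/

import Mathlib

/-- Euclidean 3-space. -/
abbrev E3 : Type := EuclideanSpace ℝ (Fin 3)

/-- A (convex) 3-polytope: the convex hull of finitely many points of `ℝ³`, of dimension 3. -/
def IsThreePolytope (P : Set E3) : Prop :=
  (∃ S : Set E3, S.Finite ∧ P = convexHull ℝ S) ∧ affineSpan ℝ P = ⊤

/-- The face lattice of a polytope, ordered by inclusion. The faces are the subsets on which some
linear functional attains its maximum over `P` (so `P` itself is a face), and the empty face. -/
abbrev FaceLattice (P : Set E3) : Type := {F : Set E3 // IsExposed ℝ P F}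

/-- Combinatorial equivalence: the face lattices are isomorphic. -/
def CombinatoriallyEquivalent (P Q : Set E3) : Prop :=
  Nonempty (FaceLattice P ≃o FaceLattice Q)

/-- An edge of `P`: a face of dimension one. -/
def IsEdge (P e : Set E3) : Prop :=
  IsExposed ℝ P e ∧ Module.finrank ℝ (affineSpan ℝ e).direction = 1

/-- The edge `e` is tangent to the unit sphere: the line spanned by `e` meets the sphere in exactly
one point (the contact point), and this point lies on `e`. -/
def IsTangentToUnitSphere (e : Set E3) : Prop :=
  ∃ t ∈ e, (affineSpan ℝ e : Set E3) ∩ Metric.sphere 0 1 = {t}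

/-- `Q` is a Koebe realization of `P`: a 3-polytope combinatorially equivalent to `P`, all of whose
edges are tangent to the unit sphere. -/
def IsKoebeRealization (P Q : Set E3) : Prop :=
  IsThreePolytope Q ∧ CombinatoriallyEquivalent Q P ∧
    ∀ e : Set E3, IsEdge Q e → IsTangentToUnitSphere e

/-- The subfield of `ℝ` generated by the coordinates of the vertices of `Q`. -/
noncomputable def coordinateField (Q : Set E3) : IntermediateField ℚ ℝ :=
  IntermediateField.adjoin ℚ {c : ℝ | ∃ v ∈ Set.extremePoints ℝ Q, ∃ i : Fin 3, c = v i}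

/-- The degree over `ℚ` of the field generated by the vertex coordinates (`⊤` if infinite). -/
noncomputable def realizationDegree (Q : Set E3) : ℕ∞ :=
  Cardinal.toENat (Module.rank ℚ (coordinateField Q))

/-- The Koebe degree of `P`: the minimal degree of a Koebe realization of `P`
(`⊤` if there is none of finite degree). -/
noncomputable def koebeDegree (P : Set E3) : ℕ∞ :=
  ⨅ (Q : Set E3) (_ : IsKoebeRealization P Q), realizationDegree Q

/-- The vertices of a regular `k`-gon in the plane `z = 0`, and two apices above and below. -/
noncomputable def bipyramidVertices (k : ℕ) : Set E3 :=
  Set.range (fun j : Fin k =>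
    (!₂[Real.cos (2 * Real.pi * j / k), Real.sin (2 * Real.pi * j / k), 0] : E3)) ∪
  {!₂[0, 0, 1], !₂[0, 0, -1]}

/-- The standard model of the bipyramid over a `k`-gon, `k ≥ 3`. -/
noncomputable def bipyramid (k : ℕ) : Set E3 := convexHull ℝ (bipyramidVertices k)

theorem isThreePolytope_bipyramid {k : ℕ} (hk : 3 ≤ k) : IsThreePolytope (bipyramid k) := by
  refine ⟨⟨bipyramidVertices k, (Set.finite_range _).union (by simp), rfl⟩, ?_⟩
  rw [bipyramid, affineSpan_convexHull]
  set S := affineSpan ℝ (bipyramidVertices k) with hS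
  have hsub : bipyramidVertices k ⊆ S := subset_affineSpan ℝ _
  have hn : (!₂[0, 0, 1] : E3) ∈ S := hsub (Or.inr (by simp))
  have hs : (!₂[0, 0, -1] : E3) ∈ S := hsub (Or.inr (by simp))
  have h0 : (0 : E3) ∈ S := by
    have := AffineMap.lineMap_mem (1 / 2 : ℝ) hn hs
    convert this using 1
    ext i
    fin_cases i <;> simp [AffineMap.lineMap_apply]
    norm_num
  have hk0 : (0 : ℝ) < k := by positivity
  have hv0 : (!₂[1, 0, 0] : E3) ∈ S := by
    refine hsub (Or.inl ⟨⟨0, by omega⟩, ?_⟩)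
    simp
  set a := 2 * Real.pi / (k : ℝ) with ha
  have hv1 : (!₂[Real.cos a, Real.sin a, 0] : E3) ∈ S := by
    refine hsub (Or.inl ⟨⟨1, by omega⟩, ?_⟩)
    simp [ha]
  have hsin : Real.sin a ≠ 0 := by
    apply ne_of_gt
    apply Real.sin_pos_of_pos_of_lt_pi
    · positivity
    · rw [ha, div_lt_iff₀ hk0]
      have : (3 : ℝ) ≤ k := by exact_mod_cast hk
      nlinarith [Real.pi_pos]
  have hd : ∀ p ∈ S, p ∈ S.direction := fun p hp => by
    simpa using AffineSubspace.vsub_mem_direction hp h0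
  rw [eq_top_iff]
  intro x _
  have hx : x = (x 1 / Real.sin a) • (!₂[Real.cos a, Real.sin a, 0] : E3) +
      (x 0 - x 1 / Real.sin a * Real.cos a) • (!₂[1, 0, 0] : E3) +
      x 2 • (!₂[0, 0, 1] : E3) := by
    ext i
    fin_cases i <;> simp [hsin]
  have hxd : x ∈ S.direction := by
    rw [hx]
    exact S.direction.add_mem (S.direction.add_mem (S.direction.smul_mem _ (hd _ hv1))
      (S.direction.smul_mem _ (hd _ hv0))) (S.direction.smul_mem _ (hd _ hn))
  simpa using AffineSubspace.vadd_mem_of_mem_direction hxd h0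

/-! Lower bound. A point x outside the unit ball is encoded by its contact circle, as the unit
vector of Lorentz space proportional to (x, 1) (`lorentzLift`). Two vertices joined by a tangent
edge have Lorentz product -1. In a Koebe realization of the bipyramid, the apices A, B and the rim
u_0, ..., u_{k-1} thus form a closed chain of circles, each tangent to the next and all tangent to A
and B. With c = -⟨A, B⟩, four-dimensional linear algebra gives u_{i+2} = t u_{i+1} - u_i + g with t
= (6 - 2c)/(1 + c) and a constant vector g (`lorentz_chain_rec`). A sequence of exact period k can
satisfy this only if t = ζ + ζ⁻¹ for a primitive k-th root of unity ζ
(`exists_isPrimitiveRoot_of_periodic_rec`). The normalizing square roots cancel in c, so t lies in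
the coordinate field K. As ζ is quadratic over K, φ(k) ≤ 2 [K : ℚ] (`totient_le_two_mul_finrank`).
This gives the bound φ(k)/2, which is stronger than the φ(k)/4 required.

Finiteness. Scaling the standard bipyramid by 1/cos(π/k) horizontally and 1/sin(π/k) vertically
makes all its edges tangent, with algebraic coordinates. This direction needs the complete list of
edges of the bipyramid (`isBipyramidEdge_of_forall_le`); the lower bound needs only that the
expected segments are edges and that a face lattice isomorphism carries them to edges
(`exists_vertex_map`).

Primes k make the bound arbitrarily large. -/

/-! ### Exposed faces and vertices of convex hulls -/

/-- The part of a convex hull on which a bounding functional attains its bound is spanned by the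
points of the generating set it contains. -/
theorem convexHull_inter_level (S : Set E3) (l : E3 →L[ℝ] ℝ) (M : ℝ) (h : ∀ s ∈ S, l s ≤ M) :
    {x ∈ convexHull ℝ S | l x = M} = convexHull ℝ {s ∈ S | l s = M} := by
  apply Set.Subset.antisymm
  · rintro x ⟨hx, hxM⟩
    -- The bound and the conclusion are put into a single convex set containing S. For positive
    -- weights, equality at a convex combination forces equality at both ends; a zero weight says
    -- nothing about its endpoint and is treated apart.
    have hC : Convex ℝ {x : E3 | l x ≤ M ∧ (l x = M → x ∈ convexHull ℝ {s ∈ S | l s = M})} := by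
      rintro x ⟨hx, hx'⟩ y ⟨hy, hy'⟩ a b ha hb hab
      simp only [Set.mem_ofPred_eq, map_add, map_smul, smul_eq_mul]
      have h1 := mul_le_mul_of_nonneg_left hx ha
      have h2 := mul_le_mul_of_nonneg_left hy hb
      have h3 : a * M + b * M = M := by rw [← add_mul, hab, one_mul]
      refine ⟨by linarith, fun he => ?_⟩
      rcases ha.eq_or_lt with rfl | ha'
      · have : b = 1 := by linarith
        subst this
        simpa using hy' (by simpa using he)
      rcases hb.eq_or_lt with rfl | hb'
      · have : a = 1 := by linarith
        subst this
        simpa using hx' (by simpa using he)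
      have hxM : l x = M := mul_left_cancel₀ ha'.ne' (by linarith)
      have hyM : l y = M := mul_left_cancel₀ hb'.ne' (by linarith)
      exact convex_convexHull ℝ _ (hx' hxM) (hy' hyM) ha hb hab
    have hSC : S ⊆ {x : E3 | l x ≤ M ∧ (l x = M → x ∈ convexHull ℝ {s ∈ S | l s = M})} :=
      fun s hs => ⟨h s hs, fun he => subset_convexHull ℝ _ ⟨hs, he⟩⟩
    exact (convexHull_min hSC hC hx).2 hxM
  · refine convexHull_min (fun s hs => ⟨subset_convexHull ℝ _ hs.1, hs.2⟩) ?_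
    exact (convex_convexHull ℝ S).inter (convex_hyperplane (f := l) l.toLinearMap.isLinear M)

theorem le_of_mem_convexHull {S : Set E3} (l : E3 →L[ℝ] ℝ) {M : ℝ} (h : ∀ s ∈ S, l s ≤ M)
    {x : E3} (hx : x ∈ convexHull ℝ S) : l x ≤ M :=
  convexHull_min (s := S) (t := {x | l x ≤ M}) h
    (convex_halfSpace_le (f := l) l.toLinearMap.isLinear M) hx

theorem isExposed_convexHull_level (S : Set E3) (l : E3 →L[ℝ] ℝ) (M : ℝ)
    (h : ∀ s ∈ S, l s ≤ M) :
    IsExposed ℝ (convexHull ℝ S) (convexHull ℝ {s ∈ S | l s = M}) := by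
  rw [← convexHull_inter_level S l M h]
  rintro ⟨z, hz, hzM⟩
  refine ⟨l, ?_⟩
  ext x
  constructor
  · rintro ⟨hx, hxM⟩
    exact ⟨hx, fun y hy => by rw [hxM]; exact le_of_mem_convexHull l h hy⟩
  · rintro ⟨hx, hmax⟩
    exact ⟨hx, le_antisymm (le_of_mem_convexHull l h hx) (hzM ▸ hmax z hz)⟩

/-- A nonempty exposed face of a convex hull is spanned by the generators it contains. -/
theorem IsExposed.exists_eq_convexHull {S e : Set E3} (he : IsExposed ℝ (convexHull ℝ S) e)
    (hne : e.Nonempty) :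
    ∃ (l : E3 →L[ℝ] ℝ) (M : ℝ), (∀ s ∈ S, l s ≤ M) ∧ (∀ x ∈ e, l x = M) ∧
      e = convexHull ℝ {s ∈ S | l s = M} := by
  obtain ⟨l, hl⟩ := he hne
  obtain ⟨z, hz⟩ := hne
  have hz' := hl ▸ hz
  have hS : ∀ s ∈ S, l s ≤ l z := fun s hs => hz'.2 s (subset_convexHull ℝ _ hs)
  have heq : e = {x ∈ convexHull ℝ S | l x = l z} := by
    rw [hl]
    ext x
    constructor
    · rintro ⟨hx, hmax⟩
      exact ⟨hx, le_antisymm (hz'.2 x hx) (hmax z hz'.1)⟩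
    · rintro ⟨hx, hxM⟩
      exact ⟨hx, fun y hy => by rw [hxM]; exact hz'.2 y hy⟩
  refine ⟨l, l z, hS, fun x hx => ?_, ?_⟩
  · rw [heq] at hx
    exact hx.2
  · rw [heq, convexHull_inter_level S l _ hS]

/-- Vertices of a polytope are exposed. -/
theorem isExposed_singleton_of_mem_extremePoints {S : Set E3} (hS : S.Finite) {v : E3}
    (hv : v ∈ Set.extremePoints ℝ (convexHull ℝ S)) : IsExposed ℝ (convexHull ℝ S) {v} := by
  have hvS : v ∈ S := extremePoints_convexHull_subset hv
  have hnot : v ∉ convexHull ℝ (S \ {v}) := fun h =>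
    ((convex_convexHull ℝ S).mem_extremePoints_iff_mem_sdiff_convexHull_sdiff.1 hv).2
      (convexHull_mono (Set.sdiff_subset_sdiff_left (subset_convexHull ℝ S)) h)
  obtain ⟨f, u, hf, hu⟩ := geometric_hahn_banach_closed_point (convex_convexHull ℝ (S \ {v}))
    ((hS.subset Set.sdiff_subset).isClosed_convexHull ℝ) hnot
  have hlt : ∀ s ∈ S, s ≠ v → f s < f v := fun s hs hsv =>
    (hf s (subset_convexHull ℝ _ ⟨hs, hsv⟩)).trans hu
  have := isExposed_convexHull_level S f (f v) fun s hs => by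
    by_cases hsv : s = v
    · rw [hsv]
    · exact (hlt s hs hsv).le
  have hset : {s ∈ S | f s = f v} = {v} := by
    ext s
    constructor
    · rintro ⟨hs, hsv⟩
      by_contra hne
      exact (hlt s hs hne).ne hsv
    · rintro rfl
      exact ⟨hvS, rfl⟩
  rwa [hset, convexHull_singleton] at this

theorem IsExposed.mem_extremePoints_of_singleton {A : Set E3} {v : E3}
    (h : IsExposed ℝ A {v}) : v ∈ Set.extremePoints ℝ A :=
  isExtreme_singleton.1 h.isExtreme

/-- A face of a polytope is the convex hull of its extreme points. -/
theorem IsExposed.eq_convexHull_extremePoints {S G : Set E3} (hS : S.Finite)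
    (hG : IsExposed ℝ (convexHull ℝ S) G) : G = convexHull ℝ (Set.extremePoints ℝ G) := by
  have hc : IsCompact G := hG.isCompact (hS.isCompact_convexHull ℝ)
  have hfin : (Set.extremePoints ℝ G).Finite :=
    hS.subset (hG.isExtreme.extremePoints_subset_extremePoints.trans extremePoints_convexHull_subset)
  have := closure_convexHull_extremePoints hc (hG.convex (convex_convexHull ℝ S))
  rwa [(hfin.isClosed_convexHull ℝ).closure_eq, eq_comm] at this

/-! ### Face lattice isomorphisms on vertices and edges -/

/-- An isomorphism of face lattices sends vertices to vertices. -/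
theorem exists_vertex_of_faceLattice_iso {S T : Set E3} (hT : T.Finite)
    (f : FaceLattice (convexHull ℝ S) ≃o FaceLattice (convexHull ℝ T)) {v : E3}
    (hv : IsExposed ℝ (convexHull ℝ S) {v}) :
    ∃ (z : E3) (hz : IsExposed ℝ (convexHull ℝ T) {z}), f ⟨{v}, hv⟩ = ⟨{z}, hz⟩ := by
  set F := f ⟨{v}, hv⟩ with hF
  have hne : F.1.Nonempty := by
    by_contra h
    rw [Set.not_nonempty_iff_eq_empty] at h
    have h1 : F ≤ f ⟨∅, isExposed_empty⟩ := by
      change F.1 ⊆ _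
      rw [h]
      exact Set.empty_subset _
    have h2 : ({v} : Set E3) ⊆ ∅ := f.le_iff_le.1 h1
    exact (h2 rfl : v ∈ (∅ : Set E3))
  have hc : IsCompact F.1 := F.2.isCompact (hT.isCompact_convexHull ℝ)
  obtain ⟨z, hz⟩ := hc.extremePoints_nonempty (E := E3) hne
  have hzT := F.2.isExtreme.extremePoints_subset_extremePoints hz
  have hzE := isExposed_singleton_of_mem_extremePoints hT hzT
  refine ⟨z, hzE, ?_⟩
  -- A singleton is a minimal nonempty face: the preimage of a vertex of the image face is a
  -- nonempty face inside {v}, hence {v} itself.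
  set G := f.symm ⟨{z}, hzE⟩ with hG
  have hfG : f G = ⟨{z}, hzE⟩ := f.apply_symm_apply _
  have hle : G ≤ ⟨{v}, hv⟩ := by
    rw [← f.le_iff_le, hfG, ← hF]
    exact Set.singleton_subset_iff.2 hz.1
  have hGne : G.1.Nonempty := by
    by_contra h
    rw [Set.not_nonempty_iff_eq_empty] at h
    have h1 : G ≤ f.symm ⟨∅, isExposed_empty⟩ := by
      change G.1 ⊆ _
      rw [h]
      exact Set.empty_subset _
    have h2 : ({z} : Set E3) ⊆ ∅ := f.symm.le_iff_le.1 h1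
    exact (h2 rfl : z ∈ (∅ : Set E3))
  have hGv : G = ⟨{v}, hv⟩ := Subtype.ext ((Set.subset_singleton_iff_eq.1 hle).resolve_left
    hGne.ne_empty)
  rw [hF, ← hGv, hfG]

/-- Combinatorially equivalent polytopes: a bijection of the vertices which preserves edges. -/
theorem exists_vertex_map {S T : Set E3} (hS : S.Finite) (hT : T.Finite)
    (f : FaceLattice (convexHull ℝ S) ≃o FaceLattice (convexHull ℝ T)) :
    ∃ g : E3 → E3,
      (∀ z ∈ Set.extremePoints ℝ (convexHull ℝ T), g z ∈ Set.extremePoints ℝ (convexHull ℝ S)) ∧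
      Set.InjOn g (Set.extremePoints ℝ (convexHull ℝ T)) ∧
      (∀ v ∈ Set.extremePoints ℝ (convexHull ℝ S),
        ∃ z ∈ Set.extremePoints ℝ (convexHull ℝ T), g z = v) ∧
      (∀ x ∈ Set.extremePoints ℝ (convexHull ℝ T), ∀ y ∈ Set.extremePoints ℝ (convexHull ℝ T),
        IsExposed ℝ (convexHull ℝ T) (segment ℝ x y) →
        IsExposed ℝ (convexHull ℝ S) (segment ℝ (g x) (g y))) := by
  have key : ∀ z : E3, ∃ v : E3, ∀ hz : IsExposed ℝ (convexHull ℝ T) {z},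
      ∃ hv : IsExposed ℝ (convexHull ℝ S) {v}, f.symm ⟨{z}, hz⟩ = ⟨{v}, hv⟩ := by
    intro z
    by_cases hz : IsExposed ℝ (convexHull ℝ T) {z}
    · obtain ⟨v, hv, h⟩ := exists_vertex_of_faceLattice_iso hS f.symm hz
      exact ⟨v, fun _ => ⟨hv, h⟩⟩
    · exact ⟨0, fun h => absurd h hz⟩
  choose g hg using key
  have hexp : ∀ z ∈ Set.extremePoints ℝ (convexHull ℝ T), IsExposed ℝ (convexHull ℝ T) {z} :=
    fun z hz => isExposed_singleton_of_mem_extremePoints hT hz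
  have hsurj : ∀ v ∈ Set.extremePoints ℝ (convexHull ℝ S),
      ∃ z ∈ Set.extremePoints ℝ (convexHull ℝ T), ∃ (hv : IsExposed ℝ (convexHull ℝ S) {v})
        (hz : IsExposed ℝ (convexHull ℝ T) {z}), f ⟨{v}, hv⟩ = ⟨{z}, hz⟩ ∧ g z = v := by
    intro v hv
    have hv' := isExposed_singleton_of_mem_extremePoints hS hv
    obtain ⟨z, hz, h⟩ := exists_vertex_of_faceLattice_iso hT f hv'
    refine ⟨z, hz.mem_extremePoints_of_singleton, hv', hz, h, ?_⟩
    obtain ⟨h1, h2⟩ := hg z hz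
    rw [← h, f.symm_apply_apply] at h2
    exact (Set.singleton_injective (congrArg Subtype.val h2)).symm
  refine ⟨g, fun z hz => ?_, ?_, fun v hv => ?_, ?_⟩
  · obtain ⟨h1, -⟩ := hg z (hexp z hz)
    exact h1.mem_extremePoints_of_singleton
  · intro x hx y hy hxy
    obtain ⟨h1, h1'⟩ := hg x (hexp x hx)
    obtain ⟨h2, h2'⟩ := hg y (hexp y hy)
    have : f.symm ⟨{x}, hexp x hx⟩ = f.symm ⟨{y}, hexp y hy⟩ := by
      rw [h1', h2']
      exact Subtype.ext (congrArg singleton hxy)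
    exact Set.singleton_injective (congrArg Subtype.val (f.symm.injective this))
  · obtain ⟨z, hz, -, -, -, h⟩ := hsurj v hv
    exact ⟨z, hz, h⟩
  · intro x hx y hy he
    set G := f.symm ⟨segment ℝ x y, he⟩ with hG
    have hmem : ∀ z (hz : z ∈ Set.extremePoints ℝ (convexHull ℝ T)), z ∈ segment ℝ x y →
        g z ∈ G.1 := by
      intro z hz hzs
      obtain ⟨h1, h2⟩ := hg z (hexp z hz)
      have : f.symm ⟨{z}, hexp z hz⟩ ≤ G := f.symm.le_iff_le.2 (Set.singleton_subset_iff.2 hzs)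
      rw [h2] at this
      exact this rfl
    -- A vertex of the preimage face comes from a vertex of T lying on the segment, and an extreme
    -- point on a segment of the polytope is one of its ends.
    have hext : Set.extremePoints ℝ G.1 ⊆ {g x, g y} := by
      intro v hv
      have hvS := G.2.isExtreme.extremePoints_subset_extremePoints hv
      obtain ⟨z, hz, hv', hz', hfz, rfl⟩ := hsurj v hvS
      have hle : f ⟨{g z}, hv'⟩ ≤ ⟨segment ℝ x y, he⟩ := by
        rw [← f.symm.le_iff_le, f.symm_apply_apply, ← hG]
        exact Set.singleton_subset_iff.2 hv.1
      rw [hfz] at hle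
      have hzs : z ∈ segment ℝ x y := hle rfl
      have := (mem_extremePoints_iff_forall_segment.1 hz).2 x hx.1 y hy.1 hzs
      rcases this with rfl | rfl <;> simp
    have hGc : Convex ℝ G.1 := G.2.convex (convex_convexHull ℝ S)
    have hseg : G.1 = segment ℝ (g x) (g y) := by
      apply Set.Subset.antisymm
      · rw [G.2.eq_convexHull_extremePoints hS, ← convexHull_pair]
        exact convexHull_mono hext
      · exact hGc.segment_subset (hmem x hx (left_mem_segment ℝ x y))
          (hmem y hy (right_mem_segment ℝ x y))
    rw [← hseg]
    exact G.2

theorem finrank_direction_segment {x y : E3} (h : x ≠ y) :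
    Module.finrank ℝ (affineSpan ℝ (segment ℝ x y)).direction = 1 := by
  rw [← convexHull_pair, affineSpan_convexHull, direction_affineSpan, vectorSpan_pair_rev]
  exact finrank_span_singleton (sub_ne_zero.2 h.symm)

/-- An edge of a polytope is the segment between two of the generators. -/
theorem IsEdge.exists_eq_segment {S e : Set E3} (hS : S.Finite)
    (he : IsEdge (convexHull ℝ S) e) :
    ∃ x ∈ S, ∃ y ∈ S, x ≠ y ∧ e = segment ℝ x y ∧
      ∃ (l : E3 →L[ℝ] ℝ) (M : ℝ), l x = M ∧ l y = M ∧ (∀ s ∈ S, l s ≤ M) ∧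
        (∀ s ∈ S, l s = M → s ∈ segment ℝ x y) := by
  have hne : e.Nonempty := by
    by_contra h
    rw [Set.not_nonempty_iff_eq_empty] at h
    have := he.2
    rw [h, AffineSubspace.span_empty, AffineSubspace.direction_bot, finrank_bot] at this
    exact zero_ne_one this
  obtain ⟨l, M, hl, hle, heq⟩ := he.1.exists_eq_convexHull hne
  set T := {s ∈ S | l s = M} with hT
  have hTne : T.Nonempty := by
    rw [← convexHull_nonempty_iff (𝕜 := ℝ), ← heq]
    exact hne
  obtain ⟨p, hp⟩ := hTne
  have hTe : T ⊆ e := heq ▸ subset_convexHull ℝ T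
  obtain ⟨⟨d, hd⟩, hd0, hspan⟩ := finrank_eq_one_iff'.1 he.2
  -- The generators on the edge are ordered by their coordinate along its line; the two extreme ones
  -- are its ends.
  have hr : ∀ s : E3, ∃ r : ℝ, s ∈ T → s = p + r • d := by
    intro s
    by_cases hs : s ∈ T
    · have hmem : s - p ∈ (affineSpan ℝ e).direction :=
        AffineSubspace.vsub_mem_direction (subset_affineSpan ℝ _ (hTe hs))
          (subset_affineSpan ℝ _ (hTe hp))
      obtain ⟨r, hr⟩ := hspan ⟨s - p, hmem⟩
      have hr' : r • d = s - p := congrArg Subtype.val hr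
      exact ⟨r, fun _ => by rw [hr']; abel⟩
    · exact ⟨0, fun h => absurd h hs⟩
  choose r hr using hr
  have hTf : T.Finite := hS.subset (Set.sep_subset _ _)
  obtain ⟨x, hx, hxmin⟩ := Set.exists_min_image T r hTf ⟨p, hp⟩
  obtain ⟨y, hy, hymax⟩ := Set.exists_max_image T r hTf ⟨p, hp⟩
  have hsub : T ⊆ segment ℝ x y := by
    intro s hs
    have h1 := hxmin s hs
    have h2 := hymax s hs
    have hmem : r s ∈ segment ℝ (r x) (r y) := by
      rw [segment_eq_Icc (h1.trans h2)]
      exact ⟨h1, h2⟩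
    obtain ⟨a, b, ha, hb, hab, hs'⟩ := hmem
    refine ⟨a, b, ha, hb, hab, ?_⟩
    rw [hr s hs, hr x hx, hr y hy, ← hs']
    have : a = 1 - b := by linarith
    subst this
    simp only [smul_eq_mul]
    module
  have heseg : e = segment ℝ x y := by
    apply Set.Subset.antisymm
    · rw [heq]
      exact convexHull_min hsub (convex_segment x y)
    · rw [heq]
      exact (convex_convexHull ℝ T).segment_subset (subset_convexHull ℝ _ hx)
        (subset_convexHull ℝ _ hy)
  refine ⟨x, hx.1, y, hy.1, ?_, heseg, l, M, hx.2, hy.2, hl, fun s hs hsM => hsub ⟨hs, hsM⟩⟩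
  rintro rfl
  have := he.2
  rw [heseg, segment_same, direction_affineSpan, vectorSpan_singleton, finrank_bot] at this
  exact zero_ne_one this

/-! ### Lorentz vectors of vertices and tangency -/

/-- The Lorentz form on `ℝ³ × ℝ`. -/
noncomputable def lorentz : LinearMap.BilinForm ℝ (E3 × ℝ) :=
  LinearMap.mk₂ ℝ (fun p q => inner ℝ p.1 q.1 - p.2 * q.2)
    (fun p p' q => by simp only [Prod.fst_add, Prod.snd_add, inner_add_left]; ring)
    (fun r p q => by
      simp only [Prod.smul_fst, Prod.smul_snd, real_inner_smul_left, smul_eq_mul]; ring)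
    (fun p q q' => by simp only [Prod.fst_add, Prod.snd_add, inner_add_right]; ring)
    (fun r p q => by
      simp only [Prod.smul_fst, Prod.smul_snd, real_inner_smul_right, smul_eq_mul]; ring)

theorem lorentz_apply (p q : E3 × ℝ) : lorentz p q = inner ℝ p.1 q.1 - p.2 * q.2 := rfl

theorem lorentz_comm (p q : E3 × ℝ) : lorentz p q = lorentz q p := by
  rw [lorentz_apply, lorentz_apply, real_inner_comm, mul_comm]

/-- Nondegeneracy, tested only on vectors of height 1: x = 0 kills the last component of p, and then
x = p.1 kills the rest. -/
theorem eq_zero_of_lorentz_eq_zero {p : E3 × ℝ} (h : ∀ x : E3, lorentz p (x, 1) = 0) : p = 0 := by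
  have h0 := h 0
  simp only [lorentz_apply, inner_zero_right, mul_one, zero_sub, neg_eq_zero] at h0
  have h1 := h p.1
  simp only [lorentz_apply, h0, zero_mul, sub_zero, inner_self_eq_zero] at h1
  exact Prod.ext h1 h0

theorem eq_zero_of_lorentz_basis {e : Fin 4 → E3 × ℝ} (he : LinearIndependent ℝ e) {p : E3 × ℝ}
    (h : ∀ i, lorentz p (e i) = 0) : p = 0 := by
  have hspan : Submodule.span ℝ (Set.range e) = ⊤ := by
    apply he.span_eq_top_of_card_eq_finrank'
    simp [Module.finrank_prod]
  apply eq_zero_of_lorentz_eq_zero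
  intro x
  have hle : Submodule.span ℝ (Set.range e) ≤ LinearMap.ker (lorentz p) := by
    rw [Submodule.span_le]
    rintro _ ⟨i, rfl⟩
    exact h i
  rw [hspan] at hle
  exact hle (Submodule.mem_top (x := (x, (1 : ℝ))))

/-- The recurrence satisfied by a chain of mutually tangent circles which are all tangent to two
given circles, in terms of the Lorentz vectors of the circles. -/
theorem lorentz_chain_rec {a b u v w : E3 × ℝ} {c : ℝ} (hc : 1 + c ≠ 0)
    (haa : lorentz a a = 1) (hbb : lorentz b b = 1) (hab : lorentz a b = -c)
    (huu : lorentz u u = 1) (hvv : lorentz v v = 1) (hww : lorentz w w = 1)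
    (hau : lorentz a u = -1) (hav : lorentz a v = -1) (haw : lorentz a w = -1)
    (hbu : lorentz b u = -1) (hbv : lorentz b v = -1) (hbw : lorentz b w = -1)
    (huv : lorentz u v = -1) (hvw : lorentz v w = -1) (huw : u ≠ w) :
    w = ((6 - 2 * c) / (1 + c)) • v - u + (4 / (1 + c)) • (a + b) := by
  have hba : lorentz b a = -c := by rw [lorentz_comm, hab]
  have hua : lorentz u a = -1 := by rw [lorentz_comm, hau]
  have hva : lorentz v a = -1 := by rw [lorentz_comm, hav]
  have hwa : lorentz w a = -1 := by rw [lorentz_comm, haw]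
  have hub : lorentz u b = -1 := by rw [lorentz_comm, hbu]
  have hvb : lorentz v b = -1 := by rw [lorentz_comm, hbv]
  have hwb : lorentz w b = -1 := by rw [lorentz_comm, hbw]
  have hvu : lorentz v u = -1 := by rw [lorentz_comm, huv]
  have hwv : lorentz w v = -1 := by rw [lorentz_comm, hvw]
  have hwu : lorentz w u = lorentz u w := lorentz_comm _ _
  -- The vector w - u is orthogonal to a, b and v, so pairing a relation with these three leaves a
  -- system in their coefficients alone, which is nonsingular because 1 + c ≠ 0.
  have hind : LinearIndependent ℝ ![a, b, v, w - u] := by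
    rw [Fintype.linearIndependent_iff]
    intro g hg
    simp only [Fin.sum_univ_four, Matrix.cons_val_zero, Matrix.cons_val_one, Matrix.cons_val] at hg
    have ha := congrArg (lorentz a) hg
    have hb := congrArg (lorentz b) hg
    have hv := congrArg (lorentz v) hg
    simp only [map_add, map_sub, map_smul, smul_eq_mul, map_zero, haa, hab, hav, hau, haw, hbb, hba,
      hbv, hbu, hbw, hva, hvb, hvv, hvu, hvw] at ha hb hv
    have e1 : g 0 * (1 + c) = g 1 * (1 + c) := by linear_combination ha - hb
    have e1' : g 0 = g 1 := mul_right_cancel₀ hc e1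
    have e2 : g 0 * (1 + c) = 0 := by
      rw [← e1'] at ha hv
      linear_combination -ha - hv
    have g0 : g 0 = 0 := (mul_eq_zero.1 e2).resolve_right hc
    have g1 : g 1 = 0 := by rw [← e1', g0]
    have g2 : g 2 = 0 := by rw [g0, g1] at hv; linarith
    have g3 : g 3 = 0 := by
      rw [g0, g1, g2] at hg
      simp only [zero_smul, zero_add, smul_eq_zero] at hg
      exact hg.resolve_right (sub_ne_zero.2 huw.symm)
    intro i
    fin_cases i <;> assumption
  -- The claimed identity is checked by pairing with this basis. The unknown product ⟨u, w⟩ appears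
  -- only against w - u, where it cancels.
  have hz := eq_zero_of_lorentz_basis hind
    (p := w - (((6 - 2 * c) / (1 + c)) • v - u + (4 / (1 + c)) • (a + b))) (by
      intro i
      fin_cases i <;>
      simp [haa, hab, hbb, hba, huu, hvv, hww, hua, hva, hwa, hub, hvb, hwb, hvu, hwv, huv, hwu,
        hav, hbv, hau, haw, hbu, hbw, hvw] <;>
      field_simp <;> ring)
  exact sub_eq_zero.1 hz

/-- The normalized Lorentz vector of the contact circle of a point outside the unit ball. -/
noncomputable def lorentzLift (x : E3) : E3 × ℝ := (√(inner ℝ x x - 1))⁻¹ • (x, (1 : ℝ))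

theorem lorentz_lorentzLift_self {x : E3} (hx : 0 < inner ℝ x x - 1) :
    lorentz (lorentzLift x) (lorentzLift x) = 1 := by
  have h := Real.sqrt_pos.2 hx
  have h2 := Real.sq_sqrt hx.le
  simp only [lorentzLift, map_smul, LinearMap.smul_apply, smul_eq_mul, lorentz_apply, mul_one]
  field_simp
  linarith

theorem lorentz_lorentzLift (x y : E3) : lorentz (lorentzLift x) (lorentzLift y) =
    (inner ℝ x y - 1) / (√(inner ℝ x x - 1) * √(inner ℝ y y - 1)) := by
  simp only [lorentzLift, map_smul, LinearMap.smul_apply, smul_eq_mul, lorentz_apply, mul_one]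
  rw [div_eq_mul_inv, mul_inv]
  ring

theorem lorentzLift_injective {x y : E3} (hx : 0 < inner ℝ x x - 1)
    (h : lorentzLift x = lorentzLift y) : x = y := by
  have h1 := congrArg Prod.fst h
  have h2 := congrArg Prod.snd h
  simp only [lorentzLift, Prod.smul_mk, smul_eq_mul, mul_one] at h1 h2
  rw [← h2] at h1
  exact smul_right_injective E3 (inv_ne_zero (Real.sqrt_pos.2 hx).ne') h1

/-- The tangency condition in coordinates: `s` is the parameter of the contact point. -/
theorem exists_of_isTangentToUnitSphere {x y : E3} (hxy : x ≠ y)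
    (h : IsTangentToUnitSphere (segment ℝ x y)) :
    ∃ s ∈ Set.Icc (0 : ℝ) 1, ∃ D : ℝ, 0 < D ∧ inner ℝ x x - 1 = s ^ 2 * D ∧
      inner ℝ y y - 1 = (1 - s) ^ 2 * D ∧ inner ℝ x y - 1 = - (s * (1 - s)) * D := by
  obtain ⟨t, ht, hline⟩ := h
  rw [← convexHull_pair, affineSpan_convexHull] at hline
  rw [segment_eq_image'] at ht
  obtain ⟨s, hs, rfl⟩ := ht
  set d := y - x with hd
  have hd0 : d ≠ 0 := sub_ne_zero.2 hxy.symm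
  have hD : 0 < inner ℝ d d := real_inner_self_pos.2 hd0
  have hmem : ∀ r : ℝ, x + r • d ∈ (line[ℝ, x, y] : Set E3) := by
    intro r
    have := AffineMap.lineMap_mem_affineSpan_pair r x y
    rwa [AffineMap.lineMap_apply, vsub_eq_sub, vadd_eq_add, add_comm] at this
  have hsph : ∀ r : ℝ, x + r • d ∈ Metric.sphere (0 : E3) 1 ↔
      inner ℝ x x + 2 * r * inner ℝ x d + r ^ 2 * inner ℝ d d = 1 := by
    intro r
    rw [mem_sphere_zero_iff_norm]
    have : ‖x + r • d‖ ^ 2 = inner ℝ x x + 2 * r * inner ℝ x d + r ^ 2 * inner ℝ d d := by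
      rw [← real_inner_self_eq_norm_sq, inner_add_left, inner_add_right, inner_add_right,
        real_inner_smul_left, real_inner_smul_left, real_inner_smul_right, real_inner_smul_right,
        real_inner_comm x d]
      ring
    rw [← this]
    constructor
    · intro h
      rw [h, one_pow]
    · intro h
      exact (pow_eq_one_iff_of_nonneg (norm_nonneg _) two_ne_zero).1 h
  have huniq : ∀ r : ℝ, inner ℝ x x + 2 * r * inner ℝ x d + r ^ 2 * inner ℝ d d = 1 → r = s := by
    intro r hr
    have : x + r • d ∈ ({x + s • d} : Set E3) := by
      rw [← hline]
      exact ⟨hmem r, (hsph r).2 hr⟩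
    exact smul_left_injective ℝ hd0 (add_left_cancel (Set.mem_singleton_iff.1 this))
  have hs1 : inner ℝ x x + 2 * s * inner ℝ x d + s ^ 2 * inner ℝ d d = 1 := by
    rw [← hsph]
    have : x + s • d ∈ ((line[ℝ, x, y] : Set E3) ∩ Metric.sphere 0 1) := by
      rw [hline]
      rfl
    exact this.2
  -- the second root of the quadratic equation coincides with the first
  have hroot : -2 * inner ℝ x d / inner ℝ d d - s = s := by
    apply huniq
    field_simp
    linear_combination inner ℝ d d * hs1
  have hxd : inner ℝ x d = - s * inner ℝ d d := by
    field_simp at hroot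
    linarith
  have hy : y = x + d := by rw [hd]; abel
  refine ⟨s, hs, inner ℝ d d, hD, ?_, ?_, ?_⟩
  · rw [hxd] at hs1
    linear_combination hs1
  · rw [hy, inner_add_left, inner_add_right, inner_add_right, real_inner_comm x d, hxd]
    rw [hxd] at hs1
    linear_combination hs1
  · rw [hy, inner_add_right, hxd]
    rw [hxd] at hs1
    linear_combination hs1

/-- The contact point lies between x and y, so s and 1 - s are nonnegative and the product of the
two square roots is s(1 - s)D. This fixes the sign: the product is -1 rather than +1. -/
theorem lorentz_lorentzLift_of_isTangent {x y : E3} (hxy : x ≠ y) (hx : 0 < inner ℝ x x - 1)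
    (hy : 0 < inner ℝ y y - 1) (h : IsTangentToUnitSphere (segment ℝ x y)) :
    lorentz (lorentzLift x) (lorentzLift y) = -1 := by
  obtain ⟨s, hs, D, hD, h1, h2, h3⟩ := exists_of_isTangentToUnitSphere hxy h
  have hs' : 0 ≤ 1 - s := by linarith [hs.2]
  have hsq : √(inner ℝ x x - 1) * √(inner ℝ y y - 1) = s * (1 - s) * D := by
    rw [h1, h2, ← Real.sqrt_mul (by positivity),
      show s ^ 2 * D * ((1 - s) ^ 2 * D) = (s * (1 - s) * D) ^ 2 by ring]
    exact Real.sqrt_sq (mul_nonneg (mul_nonneg hs.1 hs') hD.le)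
  have hne : s * (1 - s) * D ≠ 0 := by
    rw [← hsq]
    exact (mul_pos (Real.sqrt_pos.2 hx) (Real.sqrt_pos.2 hy)).ne'
  rw [lorentz_lorentzLift, hsq, h3, div_eq_iff hne]
  ring

/-- The vertices of a triangle with edges tangent to the sphere lie outside the closed ball. -/
theorem inner_self_sub_one_pos_of_triangle {x y z : E3} (hxy : x ≠ y) (hxz : x ≠ z)
    (hx : x ∉ segment ℝ y z) (h1 : IsTangentToUnitSphere (segment ℝ x y))
    (h2 : IsTangentToUnitSphere (segment ℝ x z)) (h3 : IsTangentToUnitSphere (segment ℝ y z)) :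
    0 < inner ℝ x x - 1 := by
  obtain ⟨s, hs, D, hD, e1, -, e3⟩ := exists_of_isTangentToUnitSphere hxy h1
  obtain ⟨s', hs', D', hD', e1', -, e3'⟩ := exists_of_isTangentToUnitSphere hxz h2
  -- Otherwise both edges at x touch the sphere at x itself, and y, z lie in the tangent plane
  -- there. That plane meets the sphere only in x, so the contact point of the edge yz would be x.
  by_contra hneg
  have h0 : s = 0 := by
    by_contra h
    exact hneg (by rw [e1]; positivity)
  have h0' : s' = 0 := by
    by_contra h
    exact hneg (by rw [e1']; positivity)
  subst h0 h0'
  obtain ⟨t, ht, hline⟩ := h3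
  have htS : t ∈ ((affineSpan ℝ (segment ℝ y z) : Set E3) ∩ Metric.sphere 0 1) := by
    rw [hline]
    rfl
  have htt : inner ℝ t t = (1 : ℝ) := by
    rw [real_inner_self_eq_norm_sq, mem_sphere_zero_iff_norm.1 htS.2, one_pow]
  have hxt : inner ℝ x t = (1 : ℝ) := by
    obtain ⟨p, q, hp, hq, hpq, rfl⟩ := ht
    rw [inner_add_right, real_inner_smul_right, real_inner_smul_right]
    linear_combination p * e3 + q * e3' + hpq
  have : inner ℝ (x - t) (x - t) = (0 : ℝ) := by
    rw [inner_sub_left, inner_sub_right, inner_sub_right, real_inner_comm x t, hxt, htt]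
    linear_combination e1
  rw [inner_self_eq_zero, sub_eq_zero] at this
  exact hx (this ▸ ht)

/-! ### Roots of unity and periodic linear recurrences -/

open Polynomial in
/-- A number field that contains the sum of a primitive `k`-th root of unity and its inverse has
degree at least `φ(k)/2`. -/
theorem totient_le_two_mul_finrank (K : Type*) [Field K] [Algebra ℚ K] [Algebra K ℂ]
    [IsScalarTower ℚ K ℂ] [FiniteDimensional ℚ K] {k : ℕ} (hk : 0 < k) {ζ : ℂ}
    (hζ : IsPrimitiveRoot ζ k) {t : K} (h : ζ + ζ⁻¹ = algebraMap K ℂ t) :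
    Nat.totient k ≤ 2 * Module.finrank ℚ K := by
  have hζ0 : ζ ≠ 0 := hζ.ne_zero hk.ne'
  set p : K[X] := X ^ 2 - C t * X + 1 with hp
  have hdeg : p.natDegree = 2 := by
    rw [hp]
    compute_degree!
  have hp0 : p ≠ 0 := fun h0 => by simp [h0] at hdeg
  have hroot : aeval ζ p = 0 := by
    simp only [hp, map_add, map_sub, map_mul, map_pow, aeval_X, aeval_C, map_one, ← h]
    field_simp
    ring
  have hint : IsIntegral K ζ := IsAlgebraic.isIntegral ⟨p, hp0, hroot⟩
  have hfr : Module.finrank K (IntermediateField.adjoin K {ζ}) ≤ 2 := by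
    rw [IntermediateField.adjoin.finrank hint, ← hdeg]
    exact natDegree_le_of_dvd (minpoly.dvd K ζ hroot) hp0
  have : FiniteDimensional K (IntermediateField.adjoin K {ζ}) :=
    IntermediateField.adjoin.finiteDimensional hint
  have : FiniteDimensional ℚ (IntermediateField.adjoin K {ζ}) := FiniteDimensional.trans ℚ K _
  have hmin := minpoly.natDegree_le (A := ℚ) (IntermediateField.AdjoinSimple.gen K ζ)
  have hgen : minpoly ℚ (IntermediateField.AdjoinSimple.gen K ζ) = minpoly ℚ ζ := by
    rw [← minpoly.algebraMap_eq (B := IntermediateField.adjoin K {ζ}) (B' := ℂ)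
      (FaithfulSMul.algebraMap_injective (IntermediateField.adjoin K {ζ}) ℂ)]
    rw [IntermediateField.AdjoinSimple.algebraMap_gen]
  rw [hgen, ← cyclotomic_eq_minpoly_rat hζ hk, natDegree_cyclotomic,
    ← Module.finrank_mul_finrank ℚ K (IntermediateField.adjoin K {ζ})] at hmin
  calc _ ≤ _ := hmin
    _ ≤ Module.finrank ℚ K * 2 := Nat.mul_le_mul_left _ hfr
    _ = _ := mul_comm _ _

/-- An arithmetic progression which takes a value twice is constant. -/
theorem eq_zero_of_arith_periodic {V : Type*} [AddCommGroup V] [Module ℝ V] {u : ℕ → V} {d : V}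
    (h : ∀ i, u (i + 1) = u i + d) {k : ℕ} (hk : 0 < k) (hp : u k = u 0) : d = 0 := by
  have : ∀ i : ℕ, u i = u 0 + (i : ℝ) • d := by
    intro i
    induction i with
    | zero => simp
    | succ i ih => rw [h, ih]; push_cast; module
  have h2 := this k
  rw [hp, left_eq_add, smul_eq_zero] at h2
  exact h2.resolve_left (by positivity)

/-- Solutions of `z (i + 2) = (ζ + ζ⁻¹) z (i + 1) - z i` are combinations of `ζ ^ i` and
`(ζ⁻¹) ^ i`. -/
theorem sub_mul_eq_of_rec {z : ℕ → ℂ} {ζ : ℂ} (hζ : ζ ≠ 0)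
    (hrec : ∀ i, z (i + 2) = (ζ + ζ⁻¹) * z (i + 1) - z i) (i : ℕ) :
    z (i + 1) - ζ⁻¹ * z i = ζ ^ i * (z 1 - ζ⁻¹ * z 0) := by
  induction i with
  | zero => simp
  | succ i ih =>
    rw [pow_succ', mul_assoc, ← ih, hrec]
    field_simp
    ring

/-- Both eigencomponents z(i+1) - ζ⁻¹ z(i) and z(i+1) - ζ z(i) return to their initial values at i =
j; eliminating z(j+1) leaves z(j), since ζ ≠ ζ⁻¹. -/
theorem eq_of_rec_of_pow_eq_one {z : ℕ → ℂ} {ζ : ℂ} (hζ : ζ ≠ 0) (hζ2 : ζ ^ 2 ≠ 1)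
    (hrec : ∀ i, z (i + 2) = (ζ + ζ⁻¹) * z (i + 1) - z i) {j : ℕ} (hj : ζ ^ j = 1) :
    z j = z 0 := by
  have e1 := sub_mul_eq_of_rec hζ hrec j
  have e2 := sub_mul_eq_of_rec (inv_ne_zero hζ) (z := z)
    (fun i => by rw [hrec, inv_inv, add_comm ζ]) j
  rw [inv_pow, hj, inv_one, inv_inv] at e2
  rw [hj] at e1
  have hne : ζ - ζ⁻¹ ≠ 0 := by
    intro h
    apply hζ2
    field_simp at h
    linear_combination h
  apply mul_left_cancel₀ hne
  linear_combination e1 - e2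

/-- After k steps the two eigencomponents are multiplied by ζ^k and ζ^(-k), yet unchanged by
periodicity. They cannot both vanish, so ζ^k = 1. -/
theorem pow_eq_one_of_rec {z : ℕ → ℂ} {ζ : ℂ} (hζ : ζ ≠ 0) (hζ2 : ζ ^ 2 ≠ 1)
    (hrec : ∀ i, z (i + 2) = (ζ + ζ⁻¹) * z (i + 1) - z i) {k : ℕ} (h0 : z k = z 0)
    (h1 : z (k + 1) = z 1) (hne : z 0 ≠ 0 ∨ z 1 ≠ 0) : ζ ^ k = 1 := by
  by_contra hk
  have e1 := sub_mul_eq_of_rec hζ hrec k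
  have e2 := sub_mul_eq_of_rec (inv_ne_zero hζ) (z := z)
    (fun i => by rw [hrec, inv_inv, add_comm ζ]) k
  rw [h0, h1] at e1 e2
  rw [inv_pow, inv_inv] at e2
  have x0 : z 1 - ζ⁻¹ * z 0 = 0 := by
    by_contra h
    exact hk (mul_right_cancel₀ h (by rw [← e1, one_mul]))
  have y0 : z 1 - ζ * z 0 = 0 := by
    by_contra h
    have : (ζ ^ k)⁻¹ = 1 := mul_right_cancel₀ h (by rw [← e2, one_mul])
    exact hk (inv_eq_one.1 this)
  have hne' : ζ - ζ⁻¹ ≠ 0 := by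
    intro h
    apply hζ2
    field_simp at h
    linear_combination h
  have z0 : z 0 = 0 := mul_left_cancel₀ hne' (by linear_combination x0 - y0)
  have z1 : z 1 = 0 := by rw [z0] at x0; simpa using x0
  tauto

/-- If a periodic sequence of exact period `k` solves `u (i + 2) = t u (i + 1) - u i + g`, then
`t` is the sum of a primitive `k`-th root of unity and its inverse. -/
theorem exists_isPrimitiveRoot_of_periodic_rec {V : Type*} [AddCommGroup V] [Module ℝ V]
    {u : ℕ → V} {t : ℝ} {g : V} {k : ℕ} (hk : 3 ≤ k)
    (hrec : ∀ i, u (i + 2) = t • u (i + 1) - u i + g) (hper : ∀ i, u (i + k) = u i)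
    (hinj : ∀ j, 0 < j → j < k → u j ≠ u 0) :
    ∃ ζ : ℂ, IsPrimitiveRoot ζ k ∧ ζ + ζ⁻¹ = t := by
  -- For t = 2 the first differences form a periodic arithmetic progression with step g, so g = 0;
  -- then u is a periodic arithmetic progression too, hence constant.
  have h1 : t ≠ 2 := by
    rintro rfl
    have hd : ∀ i, (fun i => u (i + 1) - u i) (i + 1) = (fun i => u (i + 1) - u i) i + g := by
      intro i
      simp only [add_assoc, one_add_one_eq_two, hrec]
      module
    have hg := eq_zero_of_arith_periodic (u := fun i => u (i + 1) - u i) hd (k := k) (by omega) (by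
      have e0 := hper 0
      have e1 := hper 1
      rw [zero_add] at e0
      rw [add_comm] at e1
      simp only [zero_add, e0, e1])
    subst hg
    have hcst : ∀ i, u (i + 1) - u i = u 1 - u 0 := by
      intro i
      induction i with
      | zero => rfl
      | succ i ih => rw [← ih]; simpa using hd i
    have := eq_zero_of_arith_periodic (u := u) (d := u 1 - u 0)
      (fun i => by rw [← hcst i]; abel) (k := k) (by omega) (by simpa using hper 0)
    exact hinj 1 (by omega) (by omega) (sub_eq_zero.1 this)
  have h2 : (2 - t) ≠ 0 := sub_ne_zero.2 h1.symm
  -- Subtracting the fixed point g/(2 - t) makes the recurrence homogeneous.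
  obtain ⟨w, hw⟩ : ∃ w : ℕ → V, ∀ i, w i = u i - (2 - t)⁻¹ • g := ⟨_, fun _ => rfl⟩
  have hwrec : ∀ i, w (i + 2) = t • w (i + 1) - w i := by
    intro i
    rw [hw, hw, hw, hrec]
    have : g = ((2 - t) * (2 - t)⁻¹) • g := by rw [mul_inv_cancel₀ h2, one_smul]
    nth_rewrite 1 [this]
    module
  have hwper : ∀ i, w (i + k) = w i := fun i => by rw [hw, hw, hper]
  have hwinj : ∀ j, 0 < j → j < k → w j ≠ w 0 := fun j hj hjk h => by
    rw [hw, hw] at h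
    exact hinj j hj hjk (sub_left_injective h)
  obtain ⟨s, hs⟩ := IsAlgClosed.exists_pow_nat_eq ((t : ℂ) ^ 2 - 4) (n := 2) (by norm_num)
  set ζ : ℂ := (t + s) / 2 with hζdef
  have hq : ζ * (t - ζ) = 1 := by
    rw [hζdef]
    linear_combination -hs / 4
  have hζ0 : ζ ≠ 0 := left_ne_zero_of_mul_eq_one hq
  have hinv : ζ⁻¹ = t - ζ := (eq_inv_of_mul_eq_one_right hq).symm
  have hsum : ζ + ζ⁻¹ = t := by rw [hinv]; ring
  -- The double roots ζ = ±1 are excluded. For ζ = -1, that is t = -2, the sequence (-1)^i w(i) is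
  -- an arithmetic progression; it has period 2k even if k is odd, so w(1) = -w(0) and w(2) = w(0),
  -- against k ≥ 3.
  have hζ2 : ζ ^ 2 ≠ 1 := by
    intro h
    rcases mul_self_eq_one_iff.1 ((sq ζ).symm.trans h) with h | h
    · rw [h] at hsum
      apply h1
      have : (t : ℂ) = (2 : ℝ) := by rw [← hsum]; push_cast; norm_num
      exact_mod_cast this
    · rw [h] at hsum
      have ht : t = -2 := by
        have : (t : ℂ) = (-2 : ℝ) := by rw [← hsum]; push_cast; norm_num
        exact_mod_cast this
      have hd : ∀ i, w (i + 2) + w (i + 1) = - (w (i + 1) + w i) := by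
        intro i
        rw [hwrec, ht]
        module
      have hd' : ∀ i, w (i + 1) + w i = (-1 : ℝ) ^ i • (w 1 + w 0) := by
        intro i
        induction i with
        | zero => simp
        | succ i ih => rw [hd, ih, pow_succ']; module
      have har : ∀ i, (fun i => (-1 : ℝ) ^ i • w i) (i + 1) =
          (fun i => (-1 : ℝ) ^ i • w i) i + (-(w 1 + w 0)) := by
        intro i
        have e : w (i + 1) = (-1 : ℝ) ^ i • (w 1 + w 0) - w i := by rw [← hd' i]; abel
        have e2 : (-1 : ℝ) ^ i * (-1 : ℝ) ^ i = 1 := by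
          rw [← mul_pow]; simp
        simp only [e, pow_succ', smul_sub, smul_smul, mul_assoc, e2]
        module
      have h0 := eq_zero_of_arith_periodic (u := fun i => (-1 : ℝ) ^ i • w i) har (k := k + k)
        (by omega) (by
        have := hwper 0
        rw [zero_add] at this
        simp only [hwper, this, Even.neg_one_pow ⟨k, rfl⟩, pow_zero])
      rw [neg_eq_zero] at h0
      apply hwinj 2 (by omega) (by omega)
      have e1 := hd 0
      rw [zero_add, zero_add, h0, neg_zero] at e1
      have : w 2 - w 0 = (w 2 + w 1) - (w 1 + w 0) := by abel
      rw [← sub_eq_zero, this, e1, h0, sub_zero]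
  -- Linear functionals reduce the vector recurrence to scalar ones. One functional separating w(1)
  -- from w(0) gives ζ^k = 1; primitivity uses all of them.
  have hz : ∀ f : Module.Dual ℝ V, ∀ i, (fun i => (f (w i) : ℂ)) (i + 2) =
      (ζ + ζ⁻¹) * (fun i => (f (w i) : ℂ)) (i + 1) - (fun i => (f (w i) : ℂ)) i := by
    intro f i
    simp only [hsum, hwrec, map_sub, map_smul, smul_eq_mul]
    push_cast
    ring
  refine ⟨ζ, IsPrimitiveRoot.mk_of_lt ζ (by omega) ?_ ?_, hsum⟩
  · have hw10 : w 1 - w 0 ≠ 0 := sub_ne_zero.2 (hwinj 1 (by omega) (by omega))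
    obtain ⟨f, hf⟩ : ∃ f : Module.Dual ℝ V, f (w 1 - w 0) ≠ 0 := by
      by_contra! h
      exact hw10 ((Module.forall_dual_apply_eq_zero_iff ℝ _).1 h)
    refine pow_eq_one_of_rec (z := fun i => (f (w i) : ℂ)) hζ0 hζ2 (hz f) (k := k) ?_ ?_ ?_
    · simpa using congrArg (fun v => (f v : ℂ)) (hwper 0)
    · simpa [add_comm] using congrArg (fun v => (f v : ℂ)) (hwper 1)
    · by_contra! h
      apply hf
      have e0 : f (w 0) = 0 := by exact_mod_cast h.1
      have e1 : f (w 1) = 0 := by exact_mod_cast h.2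
      rw [map_sub, e0, e1, sub_zero]
  · intro j hj hjk hj1
    apply hwinj j hj hjk
    rw [← sub_eq_zero, ← Module.forall_dual_apply_eq_zero_iff ℝ]
    intro f
    have := eq_of_rec_of_pow_eq_one (z := fun i => (f (w i) : ℂ)) hζ0 hζ2 (hz f) hj1
    simp only [Complex.ofReal_inj] at this
    rw [map_sub, this, sub_self]

/-! ### Vertices and edges of the standard bipyramid -/

theorem isExposed_segment_of_forall {S : Set E3} (l : E3 →L[ℝ] ℝ) {M : ℝ} {x y : E3} (hx : x ∈ S)
    (hy : y ∈ S) (hxM : l x = M) (hyM : l y = M)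
    (h : ∀ s ∈ S, s = x ∨ s = y ∨ l s < M) :
    IsExposed ℝ (convexHull ℝ S) (segment ℝ x y) := by
  have := isExposed_convexHull_level S l M fun s hs => by
    rcases h s hs with rfl | rfl | h
    · exact hxM.le
    · exact hyM.le
    · exact h.le
  have hset : {s ∈ S | l s = M} = {x, y} := by
    ext s
    constructor
    · rintro ⟨hs, hsM⟩
      rcases h s hs with rfl | rfl | h
      · simp
      · simp
      · exact absurd hsM h.ne
    · rintro (rfl | rfl)
      · exact ⟨hx, hxM⟩
      · exact ⟨hy, hyM⟩
  rwa [hset, convexHull_pair] at this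

/-- The vertices of the regular `k`-gon, indexed periodically. -/
noncomputable def rim (k j : ℕ) : E3 :=
  !₂[Real.cos (2 * Real.pi * j / k), Real.sin (2 * Real.pi * j / k), 0]

/-- The upper apex of the bipyramid. -/
noncomputable def north : E3 := !₂[0, 0, 1]

/-- The lower apex of the bipyramid. -/
noncomputable def south : E3 := !₂[0, 0, -1]

theorem mem_bipyramidVertices_iff {k : ℕ} {x : E3} :
    x ∈ bipyramidVertices k ↔ (∃ j < k, x = rim k j) ∨ x = north ∨ x = south := by
  constructor
  · rintro (⟨j, rfl⟩ | h)
    · exact Or.inl ⟨j, j.2, rfl⟩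
    · exact Or.inr h
  · rintro (⟨j, hj, rfl⟩ | h)
    · exact Or.inl ⟨⟨j, hj⟩, rfl⟩
    · exact Or.inr h

theorem finite_bipyramidVertices (k : ℕ) : (bipyramidVertices k).Finite :=
  (Set.finite_range _).union (by simp)

theorem rim_add_self {k : ℕ} (hk : 0 < k) (j : ℕ) : rim k (j + k) = rim k j := by
  have hk' : (k : ℝ) ≠ 0 := by positivity
  have : 2 * Real.pi * ((j + k : ℕ) : ℝ) / k = 2 * Real.pi * j / k + 2 * Real.pi := by
    push_cast
    field_simp
  rw [rim, rim, this, Real.cos_add_two_pi, Real.sin_add_two_pi]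

theorem rim_mod {k : ℕ} (hk : 0 < k) (j : ℕ) : rim k (j % k) = rim k j := by
  have h : ∀ n i, rim k (i + n * k) = rim k i := by
    intro n i
    induction n with
    | zero => simp
    | succ n ih => rw [add_mul, one_mul, ← add_assoc, rim_add_self hk, ih]
  conv_rhs => rw [← Nat.mod_add_div j k, mul_comm k]
  rw [h]

theorem rim_mem {k : ℕ} (hk : 0 < k) (j : ℕ) : rim k j ∈ bipyramidVertices k :=
  mem_bipyramidVertices_iff.2 (Or.inl ⟨j % k, Nat.mod_lt _ hk, (rim_mod hk j).symm⟩)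

theorem north_mem (k : ℕ) : north ∈ bipyramidVertices k :=
  mem_bipyramidVertices_iff.2 (Or.inr (Or.inl rfl))

theorem south_mem (k : ℕ) : south ∈ bipyramidVertices k :=
  mem_bipyramidVertices_iff.2 (Or.inr (Or.inr rfl))

theorem map_vec (l : E3 →L[ℝ] ℝ) (a b c : ℝ) :
    l !₂[a, b, c] = a * l !₂[1, 0, 0] + b * l !₂[0, 1, 0] + c * l !₂[0, 0, 1] := by
  have : (!₂[a, b, c] : E3) = a • !₂[1, 0, 0] + b • !₂[0, 1, 0] + c • !₂[0, 0, 1] := by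
    ext i
    fin_cases i <;> simp
  rw [this]
  simp

theorem inner_vec (a b c p q r : ℝ) :
    inner ℝ (!₂[a, b, c] : E3) !₂[p, q, r] = a * p + b * q + c * r := by
  simp [PiLp.inner_apply, Fin.sum_univ_three, mul_comm]

theorem cos_sub_lt_one {k i j : ℕ} (hi : i < k) (hj : j < k) (hij : j ≠ i) :
    Real.cos (2 * Real.pi * j / k - 2 * Real.pi * i / k) < 1 := by
  have hk : (0 : ℝ) < k := by exact_mod_cast (Nat.zero_le i).trans_lt hi
  have hi' : (i : ℝ) < k := by exact_mod_cast hi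
  have hj' : (j : ℝ) < k := by exact_mod_cast hj
  have hi0 : (0 : ℝ) ≤ i := by positivity
  have hj0 : (0 : ℝ) ≤ j := by positivity
  have hpi := Real.pi_pos
  have e : 2 * Real.pi * j / k - 2 * Real.pi * i / k = 2 * Real.pi * ((j - i) / k) := by ring
  have h1 : -1 < ((j : ℝ) - i) / k := by rw [lt_div_iff₀ hk]; linarith
  have h2 : ((j : ℝ) - i) / k < 1 := by rw [div_lt_iff₀ hk]; linarith
  refine lt_of_le_of_ne (Real.cos_le_one _) fun h => ?_
  rw [e, Real.cos_eq_one_iff_of_lt_of_lt (by nlinarith) (by nlinarith)] at h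
  have : ((j : ℝ) - i) / k = 0 := by
    rcases mul_eq_zero.1 h with h | h
    · linarith
    · exact h
  rw [div_eq_zero_iff, sub_eq_zero] at this
  rcases this with h | h
  · exact hij (by exact_mod_cast h)
  · exact hk.ne' h

theorem isExposed_rim {k : ℕ} (hk : 0 < k) (i : ℕ) : IsExposed ℝ (bipyramid k) {rim k i} := by
  rw [← rim_mod hk]
  have hi := Nat.mod_lt i hk
  generalize i % k = i at hi
  rw [← segment_same ℝ (rim k i)]
  refine isExposed_segment_of_forall (innerSL ℝ (rim k i)) (rim_mem hk i) (rim_mem hk i) rfl rfl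
    fun s hs => ?_
  have e : ∀ j, inner ℝ (rim k i) (rim k j) =
      Real.cos (2 * Real.pi * j / k - 2 * Real.pi * i / k) := by
    intro j
    rw [rim, rim, inner_vec, Real.cos_sub]
    ring
  simp only [innerSL_apply_apply, e, sub_self, Real.cos_zero]
  rcases mem_bipyramidVertices_iff.1 hs with ⟨j, hj, rfl⟩ | rfl | rfl
  · by_cases hij : j = i
    · exact Or.inl (by rw [hij])
    · exact Or.inr (Or.inr (by rw [e]; exact cos_sub_lt_one hi hj hij))
  · exact Or.inr (Or.inr (by simp [rim, north, inner_vec]))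
  · exact Or.inr (Or.inr (by simp [rim, south, inner_vec]))

theorem isExposed_north {k : ℕ} : IsExposed ℝ (bipyramid k) {north} := by
  rw [← segment_same ℝ north]
  refine isExposed_segment_of_forall (innerSL ℝ north) (north_mem k) (north_mem k) rfl rfl
    fun s hs => ?_
  rcases mem_bipyramidVertices_iff.1 hs with ⟨j, hj, rfl⟩ | rfl | rfl
  · exact Or.inr (Or.inr (by simp [rim, north, inner_vec]))
  · exact Or.inl rfl
  · exact Or.inr (Or.inr (by simp only [innerSL_apply_apply, south, north, inner_vec]; norm_num))

theorem isExposed_south {k : ℕ} : IsExposed ℝ (bipyramid k) {south} := by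
  rw [← segment_same ℝ south]
  refine isExposed_segment_of_forall (innerSL ℝ south) (south_mem k) (south_mem k) rfl rfl
    fun s hs => ?_
  rcases mem_bipyramidVertices_iff.1 hs with ⟨j, hj, rfl⟩ | rfl | rfl
  · exact Or.inr (Or.inr (by simp [rim, south, inner_vec]))
  · exact Or.inr (Or.inr (by simp only [innerSL_apply_apply, south, north, inner_vec]; norm_num))
  · exact Or.inl rfl

/-- The supporting functional is the inner product with the sum of the two ends: it is 1 at both, -1
at the other apex, and the cosine of the angular distance on the rim. -/
theorem isExposed_north_rim {k : ℕ} (hk : 0 < k) (i : ℕ) :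
    IsExposed ℝ (bipyramid k) (segment ℝ north (rim k i)) := by
  rw [← rim_mod hk]
  have hi := Nat.mod_lt i hk
  generalize i % k = i at hi
  have e : ∀ j, inner ℝ (rim k i + north) (rim k j) =
      Real.cos (2 * Real.pi * j / k - 2 * Real.pi * i / k) := by
    intro j
    rw [inner_add_left, north, rim, rim, inner_vec, inner_vec, Real.cos_sub]
    ring
  have en : inner ℝ (rim k i + north) north = (1 : ℝ) := by
    rw [inner_add_left, rim, north, inner_vec, inner_vec]; norm_num
  have es : inner ℝ (rim k i + north) south = (-1 : ℝ) := by
    simp [inner_add_left, rim, north, south, inner_vec]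
  refine isExposed_segment_of_forall (M := 1) (innerSL ℝ (rim k i + north)) (north_mem k)
    (rim_mem hk i) (by simp only [innerSL_apply_apply, en])
    (by simp only [innerSL_apply_apply, e, sub_self, Real.cos_zero]) fun s hs => ?_
  simp only [innerSL_apply_apply]
  rcases mem_bipyramidVertices_iff.1 hs with ⟨j, hj, rfl⟩ | rfl | rfl
  · by_cases hij : j = i
    · exact Or.inr (Or.inl (by rw [hij]))
    · exact Or.inr (Or.inr (by rw [e]; exact cos_sub_lt_one hi hj hij))
  · exact Or.inl rfl
  · exact Or.inr (Or.inr (by rw [es]; norm_num))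

theorem isExposed_south_rim {k : ℕ} (hk : 0 < k) (i : ℕ) :
    IsExposed ℝ (bipyramid k) (segment ℝ south (rim k i)) := by
  rw [← rim_mod hk]
  have hi := Nat.mod_lt i hk
  generalize i % k = i at hi
  have e : ∀ j, inner ℝ (rim k i + south) (rim k j) =
      Real.cos (2 * Real.pi * j / k - 2 * Real.pi * i / k) := by
    intro j
    rw [inner_add_left, south, rim, rim, inner_vec, inner_vec, Real.cos_sub]
    ring
  have en : inner ℝ (rim k i + south) north = (-1 : ℝ) := by
    simp [inner_add_left, rim, north, south, inner_vec]
  have es : inner ℝ (rim k i + south) south = (1 : ℝ) := by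
    rw [inner_add_left, rim, south, inner_vec, inner_vec]; norm_num
  refine isExposed_segment_of_forall (M := 1) (innerSL ℝ (rim k i + south)) (south_mem k)
    (rim_mem hk i) (by simp only [innerSL_apply_apply, es])
    (by simp only [innerSL_apply_apply, e, sub_self, Real.cos_zero]) fun s hs => ?_
  simp only [innerSL_apply_apply]
  rcases mem_bipyramidVertices_iff.1 hs with ⟨j, hj, rfl⟩ | rfl | rfl
  · by_cases hij : j = i
    · exact Or.inr (Or.inl (by rw [hij]))
    · exact Or.inr (Or.inr (by rw [e]; exact cos_sub_lt_one hi hj hij))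
  · exact Or.inr (Or.inr (by rw [en]; norm_num))
  · exact Or.inl rfl

theorem sin_pos_of_lt {k : ℕ} {m : ℝ} (hm : 0 < m) (hmk : m < k) :
    0 < Real.sin (Real.pi * m / k) := by
  have hk : (0 : ℝ) < k := hm.trans hmk
  have hpi := Real.pi_pos
  apply Real.sin_pos_of_pos_of_lt_pi (by positivity)
  rw [div_lt_iff₀ hk]
  exact mul_lt_mul_of_pos_left hmk hpi

theorem cos_pos_of_three_le {k : ℕ} (hk : 3 ≤ k) : 0 < Real.cos (Real.pi / k) := by
  have hk' : (3 : ℝ) ≤ k := by exact_mod_cast hk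
  have hpi := Real.pi_pos
  apply Real.cos_pos_of_mem_Ioo
  constructor
  · have : 0 < Real.pi / k := by positivity
    linarith
  · exact div_lt_div_of_pos_left hpi (by norm_num) (by linarith)

theorem isExposed_rim_rim {k : ℕ} (hk : 3 ≤ k) (i : ℕ) :
    IsExposed ℝ (bipyramid k) (segment ℝ (rim k i) (rim k (i + 1))) := by
  have hk0 : 0 < k := by omega
  have hkR : (0 : ℝ) < k := by exact_mod_cast hk0
  have hmod : rim k (i + 1) = rim k (i % k + 1) := by
    rw [← rim_mod hk0, ← rim_mod hk0 (i % k + 1), Nat.mod_add_mod]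
  rw [hmod, ← rim_mod hk0 i]
  have hi := Nat.mod_lt i hk0
  generalize i % k = i at hi
  -- The functional points towards the midpoint of the edge. It vanishes at the apices, which lie
  -- strictly below the level cos(π/k) because k ≥ 3.
  set w : E3 := !₂[Real.cos (2 * Real.pi * i / k + Real.pi / k),
    Real.sin (2 * Real.pi * i / k + Real.pi / k), 0] with hw
  have e : ∀ j, inner ℝ w (rim k j) =
      Real.cos (2 * Real.pi * j / k - (2 * Real.pi * i / k + Real.pi / k)) := by
    intro j
    rw [hw, rim, inner_vec, Real.cos_sub]
    ring
  have hc := cos_pos_of_three_le hk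
  refine isExposed_segment_of_forall (M := Real.cos (Real.pi / k)) (innerSL ℝ w) (rim_mem hk0 _)
    (rim_mem hk0 _) ?_ ?_ fun s hs => ?_
  · rw [innerSL_apply_apply, e, ← Real.cos_neg]
    congr 1
    ring
  · rw [innerSL_apply_apply, e]
    congr 1
    push_cast
    ring
  · simp only [innerSL_apply_apply]
    rcases mem_bipyramidVertices_iff.1 hs with ⟨j, hj, rfl⟩ | rfl | rfl
    · have hdiff : Real.cos (Real.pi / k) -
          Real.cos (2 * Real.pi * j / k - (2 * Real.pi * i / k + Real.pi / k)) =
          2 * (Real.sin (Real.pi * (j - i) / k) * Real.sin (Real.pi * (j - i - 1) / k)) := by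
        rw [Real.cos_sub_cos, show (Real.pi / k + (2 * Real.pi * j / k -
          (2 * Real.pi * i / k + Real.pi / k))) / 2 = Real.pi * (j - i) / k by ring,
          show (Real.pi / k - (2 * Real.pi * j / k - (2 * Real.pi * i / k + Real.pi / k))) / 2 =
          -(Real.pi * (j - i - 1) / k) by ring, Real.sin_neg]
        ring
      rw [e]
      rcases lt_trichotomy j i with hji | rfl | hji
      · by_cases hw : j = 0 ∧ i + 1 = k
        · right; left
          rw [hw.1, hw.2, ← rim_mod hk0 k, Nat.mod_self]
        · right; right
          have e1 : 0 < Real.sin (Real.pi * ((i : ℝ) - j) / k) := by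
            apply sin_pos_of_lt
            · rw [sub_pos]
              exact_mod_cast hji
            · rw [sub_lt_iff_lt_add]
              exact_mod_cast (by omega : i < k + j)
          have e2 : 0 < Real.sin (Real.pi * ((i : ℝ) + 1 - j) / k) := by
            apply sin_pos_of_lt
            · rw [sub_pos]
              exact_mod_cast (by omega : j < i + 1)
            · rw [sub_lt_iff_lt_add]
              exact_mod_cast (by omega : i + 1 < k + j)
          have := mul_pos e1 e2
          rw [← sub_pos, hdiff, show Real.pi * ((j : ℝ) - i) / k = -(Real.pi * (i - j) / k) by ring,
            show Real.pi * ((j : ℝ) - i - 1) / k = -(Real.pi * (i + 1 - j) / k) by ring,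
            Real.sin_neg, Real.sin_neg]
          linarith
      · exact Or.inl rfl
      · by_cases hw : j = i + 1
        · exact Or.inr (Or.inl (by rw [hw]))
        · right; right
          have e1 : 0 < Real.sin (Real.pi * ((j : ℝ) - i) / k) := by
            apply sin_pos_of_lt
            · rw [sub_pos]
              exact_mod_cast hji
            · rw [sub_lt_iff_lt_add]
              exact_mod_cast (by omega : j < k + i)
          have e2 : 0 < Real.sin (Real.pi * ((j : ℝ) - i - 1) / k) := by
            apply sin_pos_of_lt
            · rw [sub_sub, sub_pos]
              exact_mod_cast (by omega : i + 1 < j)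
            · rw [sub_sub, sub_lt_iff_lt_add]
              exact_mod_cast (by omega : j < k + (i + 1))
          have := mul_pos e1 e2
          rw [← sub_pos, hdiff]
          linarith
    · exact Or.inr (Or.inr (by simpa [hw, north, inner_vec] using hc))
    · exact Or.inr (Or.inr (by simpa [hw, south, inner_vec] using hc))

theorem rim_ne {k i j : ℕ} (hi : i < k) (hj : j < k) (hij : j ≠ i) : rim k j ≠ rim k i := by
  intro h
  have h1 := cos_sub_lt_one hi hj hij
  have e : inner ℝ (rim k i) (rim k j) =
      Real.cos (2 * Real.pi * j / k - 2 * Real.pi * i / k) := by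
    rw [rim, rim, inner_vec, Real.cos_sub]
    ring
  rw [← e, h, rim, inner_vec] at h1
  nlinarith [Real.cos_sq_add_sin_sq (2 * Real.pi * i / k)]

theorem rim_two (k j : ℕ) : rim k j 2 = 0 := by simp [rim]

theorem north_two : north 2 = 1 := by simp [north]

theorem south_two : south 2 = -1 := by simp [south]

theorem rim_ne_north (k j : ℕ) : rim k j ≠ north := fun h => by
  have := rim_two k j
  rw [h, north_two] at this
  exact one_ne_zero this

theorem rim_ne_south (k j : ℕ) : rim k j ≠ south := fun h => by
  have := rim_two k j
  rw [h, south_two] at this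
  norm_num at this

theorem north_ne_south : north ≠ south := fun h => by
  have := north_two
  rw [h, south_two] at this
  norm_num at this

/-- The rim is centred at the origin. Hence a functional that is nonpositive on the rim vanishes on
it, which controls supporting planes at level 0. -/
theorem sum_rim {k : ℕ} (hk : 2 ≤ k) (l : E3 →L[ℝ] ℝ) : ∑ j ∈ Finset.range k, l (rim k j) = 0 := by
  have hsum := (Complex.isPrimitiveRoot_exp k (by omega)).geom_sum_eq_zero (by omega)
  have hterm : ∀ j : ℕ, Complex.exp (2 * Real.pi * Complex.I / k) ^ j =
      ⟨Real.cos (2 * Real.pi * j / k), Real.sin (2 * Real.pi * j / k)⟩ := by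
    intro j
    rw [← Complex.exp_nat_mul, show (j : ℂ) * (2 * Real.pi * Complex.I / k) =
      ((2 * Real.pi * j / k : ℝ) : ℂ) * Complex.I by push_cast; ring]
    exact Complex.ext (Complex.exp_ofReal_mul_I_re _) (Complex.exp_ofReal_mul_I_im _)
  simp only [hterm] at hsum
  have hre := congrArg Complex.re hsum
  have him := congrArg Complex.im hsum
  simp only [Complex.re_sum, Complex.im_sum, Complex.zero_re, Complex.zero_im] at hre him
  have : ∀ j, l (rim k j) = Real.cos (2 * Real.pi * j / k) * l !₂[1, 0, 0] +
      Real.sin (2 * Real.pi * j / k) * l !₂[0, 1, 0] := by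
    intro j
    rw [rim, map_vec]
    ring
  simp only [this, Finset.sum_add_distrib, ← Finset.sum_mul, hre, him, zero_mul, add_zero]

/-- A trigonometric polynomial of degree one on the regular `k`-gon that attains its maximum at two
points attains it at two consecutive points. -/
theorem eq_one_or_of_trig_max {k m : ℕ} (hm : 1 ≤ m) (hmk : m < k) (hk : 3 ≤ k) {M N : ℝ}
    (hM : 0 < M)
    (h0 : M * Real.cos (2 * (Real.pi * m / k)) + N * Real.sin (2 * (Real.pi * m / k)) = M)
    (h1 : M * Real.cos (2 * (Real.pi / k)) + N * Real.sin (2 * (Real.pi / k)) ≤ M)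
    (h2 : M * Real.cos (2 * (Real.pi / k)) - N * Real.sin (2 * (Real.pi / k)) ≤ M) :
    m = 1 ∨ m + 1 = k := by
  by_contra! hne
  have hs : 0 < Real.sin (Real.pi / k) := by
    simpa using sin_pos_of_lt (k := k) (m := 1) one_pos (by exact_mod_cast (by omega : 1 < k))
  have hc := cos_pos_of_three_le hk
  have hsm : 0 < Real.sin (Real.pi * m / k) :=
    sin_pos_of_lt (by exact_mod_cast hm) (by exact_mod_cast hmk)
  have hsub : 0 < Real.sin (Real.pi * ((m : ℝ) - 1) / k) := by
    apply sin_pos_of_lt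
    · rw [sub_pos]
      exact_mod_cast (by omega : 1 < m)
    · rw [sub_lt_iff_lt_add]
      exact_mod_cast (by omega : m < k + 1)
  have hadd : 0 < Real.sin (Real.pi * ((m : ℝ) + 1) / k) :=
    sin_pos_of_lt (by positivity) (by exact_mod_cast (by omega : m + 1 < k))
  rw [show Real.pi * ((m : ℝ) - 1) / k = Real.pi * m / k - Real.pi / k by ring, Real.sin_sub]
    at hsub
  rw [show Real.pi * ((m : ℝ) + 1) / k = Real.pi * m / k + Real.pi / k by ring, Real.sin_add]
    at hadd
  rw [Real.cos_two_mul', Real.sin_two_mul] at h0 h1 h2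
  have p1 := Real.sin_sq_add_cos_sq (Real.pi / k)
  have p2 := Real.sin_sq_add_cos_sq (Real.pi * m / k)
  set s := Real.sin (Real.pi / k)
  set c := Real.cos (Real.pi / k)
  set S := Real.sin (Real.pi * m / k)
  set C := Real.cos (Real.pi * m / k)
  -- Since M cos 2x + N sin 2x - M = 2 sin x (N cos x - M sin x), equality at x = πm/k gives N C = M
  -- S, and the two inequalities give |N| c ≤ M s. So |tan(πm/k)| would be at most tan(π/k), which
  -- the addition formulas above forbid.
  have e0 : N * C = M * S := by
    apply mul_left_cancel₀ hsm.ne'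
    linear_combination h0 / 2 - M / 2 * p2
  have pM : M * s ^ 2 + M * c ^ 2 = M := by rw [← mul_add, p1, mul_one]
  have e1 : N * c ≤ M * s := by
    refine le_of_mul_le_mul_left ?_ hs
    linarith
  have e2 : -(N * c) ≤ M * s := by
    refine le_of_mul_le_mul_left ?_ hs
    linarith
  have key : M * (S * c) = C * (N * c) := by linear_combination -c * e0
  have h3 := mul_lt_mul_of_pos_left (sub_pos.1 hsub) hM
  have h4 : M * (-(C * s)) < M * (S * c) := mul_lt_mul_of_pos_left (by linarith) hM
  rcases le_total 0 C with hC | hC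
  · have := mul_le_mul_of_nonneg_left e1 hC
    linarith
  · have := mul_le_mul_of_nonpos_left e2 hC
    linarith

/-- The ordered pairs of adjacent vertices of the bipyramid, up to orientation. -/
def IsBipyramidEdge (k : ℕ) (x y : E3) : Prop :=
  ∃ j, x = rim k j ∧ (y = north ∨ y = south ∨ y = rim k (j + 1))

theorem isBipyramidEdge_rim_rim {k : ℕ} (hk : 3 ≤ k) {i j : ℕ} (hij : i < j) (hj : j < k)
    (l : E3 →L[ℝ] ℝ) {M : ℝ} (hx : l (rim k i) = M) (hy : l (rim k j) = M)
    (hl : ∀ s ∈ bipyramidVertices k, l s ≤ M) (hM : 0 < M) :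
    j = i + 1 ∨ rim k i = rim k (j + 1) := by
  have hk0 : 0 < k := by omega
  have hkR : (k : ℝ) ≠ 0 := by positivity
  set p := l !₂[1, 0, 0]
  set q := l !₂[0, 1, 0]
  have hval : ∀ n, l (rim k n) = Real.cos (2 * Real.pi * n / k) * p +
      Real.sin (2 * Real.pi * n / k) * q := by
    intro n
    rw [rim, map_vec]
    ring
  set θ := 2 * Real.pi * i / k with hθ
  set N := Real.cos θ * q - Real.sin θ * p with hN
  have hM' : M = Real.cos θ * p + Real.sin θ * q := by rw [← hx, hval]
  have hshift : ∀ (n : ℕ) (x : ℝ), 2 * Real.pi * n / k = θ + x →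
      l (rim k n) = M * Real.cos x + N * Real.sin x := by
    intro n x hn
    rw [hval, hn, Real.cos_add, Real.sin_add, hM', hN]
    ring
  have h0 := hshift j (2 * (Real.pi * (j - i : ℕ) / k)) (by
    rw [hθ, Nat.cast_sub hij.le]
    ring)
  have h1 := hshift (i + 1) (2 * (Real.pi / k)) (by
    rw [hθ]
    push_cast
    ring)
  -- The predecessor of vertex i, shifted by a full turn so that the index stays natural when i = 0.
  have h2 := hshift (i + k - 1) (-(2 * (Real.pi / k)) + 2 * Real.pi) (by
    rw [hθ, Nat.cast_sub (by omega)]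
    push_cast
    field_simp
    ring)
  rw [Real.cos_add_two_pi, Real.sin_add_two_pi, Real.cos_neg, Real.sin_neg] at h2
  have := eq_one_or_of_trig_max (m := j - i) (by omega) (by omega) hk hM (h0.symm.trans hy)
    (h1 ▸ hl _ (rim_mem hk0 _)) (by
      have := hl _ (rim_mem hk0 (i + k - 1))
      rw [h2] at this
      linarith)
  rcases this with h | h
  · exact Or.inl (by omega)
  · right
    rw [show j + 1 = i + k by omega, rim_add_self hk0]

/-- The edges of the bipyramid. -/
theorem isBipyramidEdge_of_forall_le {k : ℕ} (hk : 3 ≤ k) {x y : E3}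
    (hx : x ∈ bipyramidVertices k) (hy : y ∈ bipyramidVertices k) (hxy : x ≠ y)
    (l : E3 →L[ℝ] ℝ) {M : ℝ} (hxM : l x = M) (hyM : l y = M)
    (hl : ∀ s ∈ bipyramidVertices k, l s ≤ M)
    (hseg : ∀ s ∈ bipyramidVertices k, l s = M → s ∈ segment ℝ x y) :
    IsBipyramidEdge k x y ∨ IsBipyramidEdge k y x := by
  have hk0 : 0 < k := by omega
  have hsouth : l south = - l north := by
    rw [south, north, map_vec]
    ring
  have hzero : M = 0 → ∀ j < k, l (rim k j) = 0 := by
    rintro rfl j hj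
    exact (Finset.sum_eq_zero_iff_of_nonpos fun j _ => hl _ (rim_mem hk0 j)).1
      (sum_rim (by omega) l) j (Finset.mem_range.2 hj)
  have hns : ∀ s ∈ segment ℝ north south, s 0 = 0 := by
    rintro s ⟨a, b, -, -, -, rfl⟩
    simp [north, south]
  have hrr : ∀ i j, ∀ s ∈ segment ℝ (rim k i) (rim k j), s 2 = 0 := by
    rintro i j s ⟨a, b, -, -, -, rfl⟩
    simp [rim]
  have hapex : rim k 0 ∉ segment ℝ north south := by
    intro h
    have := hns _ h
    simp [rim] at this
  rcases mem_bipyramidVertices_iff.1 hx with ⟨i, hi, rfl⟩ | rfl | rfl <;>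
  rcases mem_bipyramidVertices_iff.1 hy with ⟨j, hj, rfl⟩ | rfl | rfl
  · have hM : 0 < M := by
      have h1 := hl _ (north_mem k)
      have h2 := hl _ (south_mem k)
      rw [hsouth] at h2
      refine lt_of_le_of_ne (by linarith) fun hM0 => ?_
      have := hrr i j _ (hseg _ (north_mem k) (by linarith))
      rw [north_two] at this
      exact one_ne_zero this
    rcases lt_trichotomy i j with hij | rfl | hij
    · rcases isBipyramidEdge_rim_rim hk hij hj l hxM hyM hl hM with rfl | h
      · exact Or.inl ⟨i, rfl, Or.inr (Or.inr rfl)⟩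
      · exact Or.inr ⟨j, rfl, Or.inr (Or.inr h)⟩
    · exact absurd rfl hxy
    · rcases isBipyramidEdge_rim_rim hk hij hi l hyM hxM hl hM with rfl | h
      · exact Or.inr ⟨j, rfl, Or.inr (Or.inr rfl)⟩
      · exact Or.inl ⟨i, rfl, Or.inr (Or.inr h)⟩
  · exact Or.inl ⟨i, rfl, Or.inl rfl⟩
  · exact Or.inl ⟨i, rfl, Or.inr (Or.inl rfl)⟩
  · exact Or.inr ⟨j, rfl, Or.inl rfl⟩
  · exact absurd rfl hxy
  · have hM : M = 0 := by linarith
    exact absurd (hseg _ (rim_mem hk0 0) (by rw [hzero hM 0 hk0, hM])) hapex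
  · exact Or.inr ⟨j, rfl, Or.inr (Or.inl rfl)⟩
  · have hM : M = 0 := by linarith
    have := hseg _ (rim_mem hk0 0) (by rw [hzero hM 0 hk0, hM])
    rw [segment_symm] at this
    exact absurd this hapex
  · exact absurd rfl hxy

/-! ### An explicit algebraic Koebe realization -/

/-- A line that is orthogonal to one of its points, lying on the unit sphere, is tangent. -/
theorem isTangentToUnitSphere_segment {x y : E3} {s : ℝ} (hs : s ∈ Set.Icc (0 : ℝ) 1)
    (ht : inner ℝ (x + s • (y - x)) (x + s • (y - x)) = (1 : ℝ))
    (horth : inner ℝ (x + s • (y - x)) (y - x) = (0 : ℝ)) :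
    IsTangentToUnitSphere (segment ℝ x y) := by
  refine ⟨x + s • (y - x), ?_, ?_⟩
  · rw [segment_eq_image']
    exact ⟨s, hs, rfl⟩
  rw [← convexHull_pair, affineSpan_convexHull]
  set t := x + s • (y - x) with htdef
  have htn : ‖t‖ = 1 := by
    rw [real_inner_self_eq_norm_sq] at ht
    exact (pow_eq_one_iff_of_nonneg (norm_nonneg _) two_ne_zero).1 ht
  clear_value t
  ext p
  constructor
  · rintro ⟨hp, hps⟩
    obtain ⟨r, rfl⟩ := mem_affineSpan_pair_iff_exists_lineMap_eq.1 hp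
    have e : AffineMap.lineMap x y r = t + (r - s) • (y - x) := by
      rw [AffineMap.lineMap_apply, vsub_eq_sub, vadd_eq_add, htdef]
      module
    rw [e] at hps ⊢
    rw [mem_sphere_zero_iff_norm] at hps
    have h2 : ‖t + (r - s) • (y - x)‖ ^ 2 = 1 := by rw [hps, one_pow]
    rw [← real_inner_self_eq_norm_sq, inner_add_left, inner_add_right, inner_add_right, ht,
      real_inner_comm t, real_inner_smul_right, horth] at h2
    have h3 : inner ℝ ((r - s) • (y - x)) ((r - s) • (y - x)) = (0 : ℝ) := by linarith
    rw [inner_self_eq_zero] at h3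
    rw [h3, add_zero]
    rfl
  · rintro rfl
    refine ⟨?_, by rwa [mem_sphere_zero_iff_norm]⟩
    have := AffineMap.lineMap_mem_affineSpan_pair s x y
    rwa [AffineMap.lineMap_apply, vsub_eq_sub, vadd_eq_add, add_comm, ← htdef] at this

theorem IsExposed.image_equiv (D : E3 ≃L[ℝ] E3) {A B : Set E3} (h : IsExposed ℝ A B) :
    IsExposed ℝ (D '' A) (D '' B) := by
  intro hne
  obtain ⟨l, rfl⟩ := h (Set.image_nonempty.1 hne)
  refine ⟨l.comp (D.symm : E3 →L[ℝ] E3), ?_⟩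
  ext x
  constructor
  · rintro ⟨y, ⟨hy, hmax⟩, rfl⟩
    refine ⟨⟨y, hy, rfl⟩, ?_⟩
    rintro _ ⟨z, hz, rfl⟩
    simpa using hmax z hz
  · rintro ⟨⟨y, hy, rfl⟩, hmax⟩
    refine ⟨y, ⟨hy, fun z hz => ?_⟩, rfl⟩
    simpa using hmax (D z) ⟨z, hz, rfl⟩

theorem symm_image_image_equiv (D : E3 ≃L[ℝ] E3) (A : Set E3) :
    D.symm '' (D '' A) = A := by
  rw [Set.image_image]
  simp

/-- Linearly equivalent polytopes are combinatorially equivalent. -/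
theorem combinatoriallyEquivalent_image (D : E3 ≃L[ℝ] E3) (A : Set E3) :
    CombinatoriallyEquivalent (D '' A) A :=
  ⟨{ toFun := fun F => ⟨D.symm '' F.1, by
        have := F.2.image_equiv D.symm
        rwa [symm_image_image_equiv] at this⟩
     invFun := fun F => ⟨D '' F.1, F.2.image_equiv D⟩
     left_inv := fun F => Subtype.ext (symm_image_image_equiv D.symm F.1)
     right_inv := fun F => Subtype.ext (symm_image_image_equiv D F.1)
     map_rel_iff' := fun {F G} => Set.image_subset_image_iff D.symm.injective }⟩

theorem CombinatoriallyEquivalent.symm {P Q : Set E3} (h : CombinatoriallyEquivalent P Q) :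
    CombinatoriallyEquivalent Q P := h.map OrderIso.symm

theorem CombinatoriallyEquivalent.trans {P Q R : Set E3} (h : CombinatoriallyEquivalent P Q)
    (h' : CombinatoriallyEquivalent Q R) : CombinatoriallyEquivalent P R := by
  obtain ⟨f⟩ := h
  obtain ⟨g⟩ := h'
  exact ⟨f.trans g⟩

theorem IsThreePolytope.image_equiv (D : E3 ≃L[ℝ] E3) {P : Set E3} (hP : IsThreePolytope P) :
    IsThreePolytope (D '' P) := by
  obtain ⟨⟨S, hS, rfl⟩, hspan⟩ := hP
  refine ⟨⟨D '' S, hS.image _, (D : E3 →ₗ[ℝ] E3).image_convexHull S⟩, ?_⟩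
  exact AffineMap.span_eq_top_of_surjective (D : E3 →ₗ[ℝ] E3).toAffineMap D.surjective hspan

/-- The diagonal map with entries `a, a, c`. -/
noncomputable def stretch (a c : ℝ) (ha : a ≠ 0) (hc : c ≠ 0) : E3 ≃L[ℝ] E3 :=
  LinearEquiv.toContinuousLinearEquiv
    { toFun := fun x => !₂[a * x 0, a * x 1, c * x 2]
      invFun := fun x => !₂[a⁻¹ * x 0, a⁻¹ * x 1, c⁻¹ * x 2]
      map_add' := fun x y => by ext i; fin_cases i <;> simp [mul_add]
      map_smul' := fun r x => by ext i; fin_cases i <;> simp [mul_left_comm]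
      left_inv := fun x => by ext i; fin_cases i <;> simp [ha, hc]
      right_inv := fun x => by ext i; fin_cases i <;> simp [ha, hc] }

theorem stretch_apply {a c : ℝ} (ha : a ≠ 0) (hc : c ≠ 0) (x : E3) :
    stretch a c ha hc x = !₂[a * x 0, a * x 1, c * x 2] := rfl

theorem stretch_vec {a c : ℝ} (ha : a ≠ 0) (hc : c ≠ 0) (x y z : ℝ) :
    stretch a c ha hc !₂[x, y, z] = !₂[a * x, a * y, c * z] := rfl

theorem vec_lineMap (a b c p q r s : ℝ) :
    (!₂[a, b, c] + s • (!₂[p, q, r] - !₂[a, b, c]) : E3) =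
      !₂[a + s * (p - a), b + s * (q - b), c + s * (r - c)] := by
  ext i
  fin_cases i <;> simp

theorem vec_sub (a b c p q r : ℝ) :
    (!₂[p, q, r] - !₂[a, b, c] : E3) = !₂[p - a, q - b, r - c] := by
  ext i
  fin_cases i <;> simp

/-- The edges of the suitably stretched bipyramid are tangent to the sphere. -/
theorem isTangentToUnitSphere_stretch {k : ℕ} {a c α : ℝ} (hα : α = Real.pi / k)
    (haα : a * Real.cos α = 1) (hcα : c * Real.sin α = 1) (ha : a ≠ 0) (hc : c ≠ 0) {x y : E3}
    (hxy : IsBipyramidEdge k x y) :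
    IsTangentToUnitSphere (segment ℝ (stretch a c ha hc x) (stretch a c ha hc y)) := by
  obtain ⟨j, rfl, hy⟩ := hxy
  have hθ := Real.sin_sq_add_cos_sq (2 * Real.pi * j / k)
  have hsc := Real.sin_sq_add_cos_sq α
  have hapex : ∀ ε : ℝ, ε ^ 2 = 1 →
      IsTangentToUnitSphere (segment ℝ (stretch a c ha hc (rim k j))
        (stretch a c ha hc !₂[0, 0, ε])) := by
    intro ε hε
    rw [rim, stretch_vec, stretch_vec]
    set C := Real.cos (2 * Real.pi * j / k)
    set S := Real.sin (2 * Real.pi * j / k)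
    -- The parameter sin² α is the foot of the perpendicular from the origin; its distance is 1
    -- because 1/a² + 1/c² = cos² α + sin² α = 1.
    have hpt : (!₂[a * C, a * S, c * 0] + (Real.sin α ^ 2) •
        (!₂[a * 0, a * 0, c * ε] - !₂[a * C, a * S, c * 0]) : E3) =
        !₂[Real.cos α * C, Real.cos α * S, ε * Real.sin α] := by
      rw [vec_lineMap]
      congr 2
      · linear_combination (-a * C) * hsc + C * Real.cos α * haα
      congr 1
      · linear_combination (-a * S) * hsc + S * Real.cos α * haα
      congr 1
      · linear_combination ε * Real.sin α * hcα
    refine isTangentToUnitSphere_segment (s := Real.sin α ^ 2) ⟨by positivity, ?_⟩ ?_ ?_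
    · nlinarith [sq_nonneg (Real.cos α)]
    · rw [hpt, inner_vec]
      linear_combination Real.cos α ^ 2 * hθ + Real.sin α ^ 2 * hε + hsc
    · rw [hpt, vec_sub, inner_vec]
      linear_combination (-Real.cos α * a) * hθ + (Real.sin α * c) * hε - haα + hcα
  rcases hy with rfl | rfl | rfl
  · exact hapex 1 (by norm_num)
  · exact hapex (-1) (by norm_num)
  · have hθ' := Real.sin_sq_add_cos_sq (2 * Real.pi * (j + 1 : ℕ) / k)
    have hdiff := Real.cos_sub (2 * Real.pi * (j + 1 : ℕ) / k) (2 * Real.pi * j / k)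
    rw [show 2 * Real.pi * (j + 1 : ℕ) / k - 2 * Real.pi * j / k = 2 * α by
      rw [hα]; push_cast; ring, Real.cos_two_mul] at hdiff
    rw [rim, rim, stretch_vec, stretch_vec]
    set C := Real.cos (2 * Real.pi * j / k)
    set S := Real.sin (2 * Real.pi * j / k)
    set C' := Real.cos (2 * Real.pi * (j + 1 : ℕ) / k)
    set S' := Real.sin (2 * Real.pi * (j + 1 : ℕ) / k)
    -- By symmetry a rim edge touches at its midpoint, at distance a cos α = 1 from the origin.
    refine isTangentToUnitSphere_segment (s := 1 / 2) ⟨by norm_num, by norm_num⟩ ?_ ?_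
    · rw [vec_lineMap, inner_vec]
      linear_combination a ^ 2 / 4 * (hθ + hθ' - 2 * hdiff) + (a * Real.cos α + 1) * haα
    · rw [vec_lineMap, vec_sub, inner_vec]
      linear_combination a ^ 2 / 2 * (hθ' - hθ)

theorem isAlgebraic_cos_div (n k : ℕ) : IsAlgebraic ℚ (Real.cos (Real.pi * n / k)) := by
  have := (Real.isAlgebraic_cos_rat_mul_pi (n / k : ℚ)).extendScalars
    (S := ℚ) (FaithfulSMul.algebraMap_injective ℤ ℚ)
  convert this using 2
  push_cast
  ring

theorem isAlgebraic_sin_div (n k : ℕ) : IsAlgebraic ℚ (Real.sin (Real.pi * n / k)) := by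
  have := (Real.isAlgebraic_sin_rat_mul_pi (n / k : ℚ)).extendScalars
    (S := ℚ) (FaithfulSMul.algebraMap_injective ℤ ℚ)
  convert this using 2
  push_cast
  ring

theorem isAlgebraic_bipyramidVertices {k : ℕ} {x : E3} (hx : x ∈ bipyramidVertices k) (i : Fin 3) :
    IsAlgebraic ℚ (x i) := by
  rcases mem_bipyramidVertices_iff.1 hx with ⟨j, -, rfl⟩ | rfl | rfl
  · have e : 2 * Real.pi * j / k = Real.pi * (2 * j : ℕ) / k := by push_cast; ring
    rw [rim, e]
    fin_cases i
    · exact isAlgebraic_cos_div _ _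
    · exact isAlgebraic_sin_div _ _
    · exact isAlgebraic_zero
  · fin_cases i
    · exact isAlgebraic_zero
    · exact isAlgebraic_zero
    · exact isAlgebraic_one
  · fin_cases i
    · exact isAlgebraic_zero
    · exact isAlgebraic_zero
    · exact isAlgebraic_one.neg

theorem finiteDimensional_coordinateField {S : Set E3} (hS : S.Finite)
    (halg : ∀ x ∈ S, ∀ i, IsAlgebraic ℚ (x i)) :
    FiniteDimensional ℚ (coordinateField (convexHull ℝ S)) := by
  have hfin :
      {c : ℝ | ∃ v ∈ Set.extremePoints ℝ (convexHull ℝ S), ∃ i : Fin 3, c = v i}.Finite := by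
    refine (hS.image2 (fun (v : E3) (i : Fin 3) => v i) (Set.finite_univ)).subset ?_
    rintro c ⟨v, hv, i, rfl⟩
    exact ⟨v, extremePoints_convexHull_subset hv, i, Set.mem_univ _, rfl⟩
  have := hfin.to_subtype
  refine IntermediateField.finiteDimensional_adjoin ?_
  rintro c ⟨v, hv, i, rfl⟩
  exact (halg v (extremePoints_convexHull_subset hv) i).isIntegral

/-- The bipyramid over a `k`-gon has a Koebe realization with algebraic coordinates. -/
theorem exists_isKoebeRealization_bipyramid {k : ℕ} (hk : 3 ≤ k) :
    ∃ Q, IsKoebeRealization (bipyramid k) Q ∧ FiniteDimensional ℚ (coordinateField Q) := by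
  have hcos := cos_pos_of_three_le hk
  have hsin : 0 < Real.sin (Real.pi / k) := by
    simpa using sin_pos_of_lt (k := k) (m := 1) one_pos (by exact_mod_cast (by omega : 1 < k))
  have ha : (Real.cos (Real.pi / k))⁻¹ ≠ 0 := inv_ne_zero hcos.ne'
  have hc : (Real.sin (Real.pi / k))⁻¹ ≠ 0 := inv_ne_zero hsin.ne'
  set D := stretch _ _ ha hc with hD
  have himg : D '' bipyramid k = convexHull ℝ (D '' bipyramidVertices k) :=
    (D : E3 →ₗ[ℝ] E3).image_convexHull _
  have hfin : (D '' bipyramidVertices k).Finite := (finite_bipyramidVertices k).image _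
  refine ⟨D '' bipyramid k, ⟨(isThreePolytope_bipyramid hk).image_equiv D,
    combinatoriallyEquivalent_image D _, fun e he => ?_⟩, ?_⟩
  · rw [himg] at he
    obtain ⟨_, ⟨x, hx, rfl⟩, _, ⟨y, hy, rfl⟩, hxy, rfl, l, M, hxM, hyM, hl, hseg⟩ :=
      he.exists_eq_segment hfin
    have hedge := isBipyramidEdge_of_forall_le hk hx hy (fun h => hxy (congrArg D h))
      (l.comp (D : E3 →L[ℝ] E3)) hxM hyM (fun s hs => hl _ ⟨s, hs, rfl⟩) (fun s hs hsM => by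
        obtain ⟨p, q, hp, hq, hpq, h⟩ := hseg _ ⟨s, hs, rfl⟩ hsM
        exact ⟨p, q, hp, hq, hpq, D.injective (by rw [map_add, map_smul, map_smul, h])⟩)
    rcases hedge with h | h
    · exact isTangentToUnitSphere_stretch rfl (inv_mul_cancel₀ hcos.ne')
        (inv_mul_cancel₀ hsin.ne') ha hc h
    · rw [segment_symm]
      exact isTangentToUnitSphere_stretch rfl (inv_mul_cancel₀ hcos.ne')
        (inv_mul_cancel₀ hsin.ne') ha hc h
  · rw [himg]
    refine finiteDimensional_coordinateField hfin ?_
    rintro _ ⟨x, hx, rfl⟩ i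
    have hx' := isAlgebraic_bipyramidVertices hx
    have h1 : IsAlgebraic ℚ (Real.cos (Real.pi / k))⁻¹ := by
      simpa using (isAlgebraic_cos_div 1 k).inv
    have h2 : IsAlgebraic ℚ (Real.sin (Real.pi / k))⁻¹ := by
      simpa using (isAlgebraic_sin_div 1 k).inv
    rw [hD, stretch_apply]
    fin_cases i
    · exact h1.mul (hx' 0)
    · exact h1.mul (hx' 1)
    · exact h2.mul (hx' 2)

/-! ### The degree bound -/

theorem inner_mem_coordinateField {Q : Set E3} {x y : E3} (hx : x ∈ Set.extremePoints ℝ Q)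
    (hy : y ∈ Set.extremePoints ℝ Q) : inner ℝ x y ∈ coordinateField Q := by
  have h : ∀ v ∈ Set.extremePoints ℝ Q, ∀ i, v i ∈ coordinateField Q := fun v hv i =>
    IntermediateField.subset_adjoin ℚ _ ⟨v, hv, i, rfl⟩
  rw [PiLp.inner_apply]
  exact sum_mem fun i _ => mul_mem (h y hy i) (h x hx i)

theorem natCast_le_realizationDegree {Q : Set E3} {n : ℕ}
    (h : FiniteDimensional ℚ (coordinateField Q) → n ≤ Module.finrank ℚ (coordinateField Q)) :
    (n : ℕ∞) ≤ realizationDegree Q := by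
  rw [realizationDegree]
  by_cases hfin : FiniteDimensional ℚ (coordinateField Q)
  · rw [← Module.finrank_eq_rank, Cardinal.toENat_nat]
    exact_mod_cast h hfin
  · rw [Cardinal.toENat_eq_top.2]
    · exact le_top
    · by_contra hlt
      exact hfin (Module.rank_lt_aleph0_iff.1 (not_le.1 hlt))

/-- A vector of Lorentz space that is orthogonal to all vertices of a 3-polytope is zero. -/
theorem eq_zero_of_lorentz_extremePoints {S : Set E3} (hS : S.Finite)
    (hspan : affineSpan ℝ (convexHull ℝ S) = ⊤) {p : E3 × ℝ}
    (h : ∀ x ∈ Set.extremePoints ℝ (convexHull ℝ S), lorentz p (x, 1) = 0) : p = 0 := by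
  let H : AffineSubspace ℝ E3 :=
    { carrier := {x | lorentz p (x, 1) = 0}
      smul_vsub_vadd_mem' := by
        intro c x y z hx hy hz
        simp only [Set.mem_ofPred_eq, lorentz_apply, mul_one, vsub_eq_sub, vadd_eq_add,
          inner_add_right, real_inner_smul_right, inner_sub_right] at hx hy hz ⊢
        linear_combination c * (hx - hy) + hz }
  have hsub : convexHull ℝ S ⊆ H := by
    rw [(IsExposed.refl (convexHull ℝ S)).eq_convexHull_extremePoints hS]
    exact convexHull_min h H.convex
  have htop : (⊤ : AffineSubspace ℝ E3) ≤ H := by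
    rw [← hspan]
    exact affineSpan_le.2 hsub
  exact eq_zero_of_lorentz_eq_zero fun x => htop (AffineSubspace.mem_top ℝ E3 x)

theorem rim_ne_rim_add {k i m : ℕ} (hm : 0 < m) (hmk : m < k) : rim k i ≠ rim k (i + m) := by
  have hk : 0 < k := by omega
  rw [← rim_mod hk i, ← rim_mod hk (i + m)]
  refine rim_ne (Nat.mod_lt _ hk) (Nat.mod_lt _ hk) fun h => ?_
  have hdvd := (Nat.modEq_iff_dvd' (Nat.le_add_right i m)).1 h
  rw [Nat.add_sub_cancel_left] at hdvd
  exact absurd (Nat.le_of_dvd hm hdvd) (not_le.2 hmk)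

/-- The lower bound for the degree of a Koebe realization of the bipyramid. -/
theorem totient_le_of_isKoebeRealization {k : ℕ} (hk : 3 ≤ k) {Q : Set E3}
    (hQ : IsKoebeRealization (bipyramid k) Q) [FiniteDimensional ℚ (coordinateField Q)] :
    Nat.totient k ≤ 2 * Module.finrank ℚ (coordinateField Q) := by
  have hk0 : 0 < k := by omega
  obtain ⟨⟨⟨S, hS, rfl⟩, hspan⟩, ⟨f⟩, htan⟩ := hQ
  obtain ⟨g, hgext, hginj, hgsurj, hgseg⟩ :=
    exists_vertex_map hS (finite_bipyramidVertices k) f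
  have extR : ∀ i, rim k i ∈ Set.extremePoints ℝ (bipyramid k) := fun i =>
    (isExposed_rim hk0 i).mem_extremePoints_of_singleton
  have extN : north ∈ Set.extremePoints ℝ (bipyramid k) :=
    isExposed_north.mem_extremePoints_of_singleton
  have extS : south ∈ Set.extremePoints ℝ (bipyramid k) :=
    isExposed_south.mem_extremePoints_of_singleton
  have hne : ∀ x ∈ Set.extremePoints ℝ (bipyramid k), ∀ y ∈ Set.extremePoints ℝ (bipyramid k),
      x ≠ y → g x ≠ g y := fun x hx y hy hxy h => hxy (hginj hx hy h)
  have htang : ∀ x ∈ Set.extremePoints ℝ (bipyramid k),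
      ∀ y ∈ Set.extremePoints ℝ (bipyramid k), x ≠ y →
      IsExposed ℝ (bipyramid k) (segment ℝ x y) →
      IsTangentToUnitSphere (segment ℝ (g x) (g y)) := fun x hx y hy hxy he =>
    htan _ ⟨hgseg x hx y hy he, finrank_direction_segment (hne x hx y hy hxy)⟩
  have hrim : ∀ i, rim k i ≠ rim k (i + 1) := fun i => rim_ne_rim_add one_pos (by omega)
  have tNR : ∀ i, IsTangentToUnitSphere (segment ℝ (g north) (g (rim k i))) := fun i =>
    htang _ extN _ (extR i) (rim_ne_north k i).symm (isExposed_north_rim hk0 i)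
  have tSR : ∀ i, IsTangentToUnitSphere (segment ℝ (g south) (g (rim k i))) := fun i =>
    htang _ extS _ (extR i) (rim_ne_south k i).symm (isExposed_south_rim hk0 i)
  have tRR : ∀ i, IsTangentToUnitSphere (segment ℝ (g (rim k i)) (g (rim k (i + 1)))) := fun i =>
    htang _ (extR i) _ (extR (i + 1)) (hrim i) (isExposed_rim_rim hk i)
  have hnotin : ∀ x ∈ Set.extremePoints ℝ (bipyramid k), ∀ y ∈ Set.extremePoints ℝ (bipyramid k),
      ∀ z ∈ Set.extremePoints ℝ (bipyramid k), x ≠ y → x ≠ z → g x ∉ segment ℝ (g y) (g z) := by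
    intro x hx y hy z hz hxy hxz h
    rcases (mem_extremePoints_iff_forall_segment.1 (hgext x hx)).2 _ (hgext y hy).1 _
      (hgext z hz).1 h with h | h
    · exact hne x hx y hy hxy h.symm
    · exact hne x hx z hz hxz h.symm
  have pN : 0 < inner ℝ (g north) (g north) - 1 :=
    inner_self_sub_one_pos_of_triangle (hne _ extN _ (extR 0) (rim_ne_north k 0).symm)
      (hne _ extN _ (extR 1) (rim_ne_north k 1).symm)
      (hnotin _ extN _ (extR 0) _ (extR 1) (rim_ne_north k 0).symm (rim_ne_north k 1).symm)
      (tNR 0) (tNR 1) (tRR 0)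
  have pS : 0 < inner ℝ (g south) (g south) - 1 :=
    inner_self_sub_one_pos_of_triangle (hne _ extS _ (extR 0) (rim_ne_south k 0).symm)
      (hne _ extS _ (extR 1) (rim_ne_south k 1).symm)
      (hnotin _ extS _ (extR 0) _ (extR 1) (rim_ne_south k 0).symm (rim_ne_south k 1).symm)
      (tSR 0) (tSR 1) (tRR 0)
  have pR : ∀ i, 0 < inner ℝ (g (rim k i)) (g (rim k i)) - 1 := fun i =>
    inner_self_sub_one_pos_of_triangle (hne _ (extR i) _ extN (rim_ne_north k i))
      (hne _ (extR i) _ (extR (i + 1)) (hrim i))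
      (hnotin _ (extR i) _ extN _ (extR (i + 1)) (rim_ne_north k i) (hrim i))
      (segment_symm ℝ (g north) _ ▸ tNR i) (tRR i) (tNR (i + 1))
  obtain ⟨u, hu⟩ : ∃ u : ℕ → E3 × ℝ, ∀ i, u i = lorentzLift (g (rim k i)) := ⟨_, fun _ => rfl⟩
  obtain ⟨A, hA⟩ : ∃ A, A = lorentzLift (g north) := ⟨_, rfl⟩
  obtain ⟨B, hB⟩ : ∃ B, B = lorentzLift (g south) := ⟨_, rfl⟩
  obtain ⟨c, hc⟩ : ∃ c : ℝ, lorentz A B = -c := ⟨-lorentz A B, (neg_neg _).symm⟩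
  have lAA : lorentz A A = 1 := hA ▸ lorentz_lorentzLift_self pN
  have lBB : lorentz B B = 1 := hB ▸ lorentz_lorentzLift_self pS
  have luu : ∀ i, lorentz (u i) (u i) = 1 := fun i => hu i ▸ lorentz_lorentzLift_self (pR i)
  have lAu : ∀ i, lorentz A (u i) = -1 := fun i => by
    rw [hA, hu]
    exact lorentz_lorentzLift_of_isTangent (hne _ extN _ (extR i) (rim_ne_north k i).symm) pN (pR i)
      (tNR i)
  have lBu : ∀ i, lorentz B (u i) = -1 := fun i => by
    rw [hB, hu]
    exact lorentz_lorentzLift_of_isTangent (hne _ extS _ (extR i) (rim_ne_south k i).symm) pS (pR i)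
      (tSR i)
  have lu : ∀ i, lorentz (u i) (u (i + 1)) = -1 := fun i => by
    rw [hu, hu]
    exact lorentz_lorentzLift_of_isTangent (hne _ (extR i) _ (extR (i + 1)) (hrim i)) (pR i)
      (pR (i + 1)) (tRR i)
  -- If ⟨A, B⟩ = 1, then A - B is orthogonal to A, B and every u_i, that is, to the lifts of all
  -- vertices. These span, so A = B and the two apices coincide.
  have hc1 : 1 + c ≠ 0 := by
    intro h0
    have hAB : lorentz A B = 1 := by linarith
    have hlift : ∀ x : E3, 0 < inner ℝ x x - 1 → lorentz (A - B) (lorentzLift x) = 0 →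
        lorentz (A - B) (x, 1) = 0 := by
      intro x hx h
      rw [lorentzLift, map_smul, smul_eq_mul] at h
      exact (mul_eq_zero.1 h).resolve_left (inv_ne_zero (Real.sqrt_pos.2 hx).ne')
    have hzero : A - B = 0 := by
      refine eq_zero_of_lorentz_extremePoints hS hspan fun x hx => ?_
      obtain ⟨z, hz, rfl⟩ := hgsurj x hx
      rcases mem_bipyramidVertices_iff.1 (extremePoints_convexHull_subset hz) with
        ⟨j, -, rfl⟩ | rfl | rfl
      · refine hlift _ (pR j) ?_
        rw [← hu, map_sub, LinearMap.sub_apply, lAu, lBu, sub_self]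
      · refine hlift _ pN ?_
        rw [← hA, map_sub, LinearMap.sub_apply, lAA, lorentz_comm, hAB, sub_self]
      · refine hlift _ pS ?_
        rw [← hB, map_sub, LinearMap.sub_apply, lBB, hAB, sub_self]
    rw [sub_eq_zero, hA, hB] at hzero
    exact hne _ extN _ extS north_ne_south (lorentzLift_injective pN hzero)
  have hune : ∀ i m, 0 < m → m < k → u i ≠ u (i + m) := fun i m hm hmk h => by
    rw [hu, hu] at h
    exact hne _ (extR i) _ (extR (i + m)) (rim_ne_rim_add hm hmk) (lorentzLift_injective (pR i) h)
  obtain ⟨ζ, hζ, hsum⟩ := exists_isPrimitiveRoot_of_periodic_rec hk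
    (fun i => lorentz_chain_rec hc1 lAA lBB hc (luu i) (luu (i + 1)) (luu (i + 2)) (lAu i)
      (lAu (i + 1)) (lAu (i + 2)) (lBu i) (lBu (i + 1)) (lBu (i + 2)) (lu i) (lu (i + 1))
      (hune i 2 (by omega) (by omega)))
    (fun i => by rw [hu, hu, rim_add_self hk0])
    (fun j hj hjk h => hune 0 j hj hjk (by rw [zero_add, h]))
  set K := coordinateField (convexHull ℝ S)
  -- Since ⟨A, u_0⟩⟨B, u_0⟩ = 1, one has c = -⟨A, B⟩⟨u_0, u_0⟩ / (⟨A, u_0⟩⟨B, u_0⟩). In this ratio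
  -- every normalizing factor cancels, leaving only inner products of vertices.
  have hcK : c ∈ K := by
    have mN := hgext _ extN
    have mS := hgext _ extS
    have mR := hgext _ (extR 0)
    have hNR := lAu 0
    have hSR := lBu 0
    rw [hA, hu, lorentz_lorentzLift] at hNR
    rw [hB, hu, lorentz_lorentzLift] at hSR
    rw [hA, hB, lorentz_lorentzLift] at hc
    have sN := Real.sqrt_pos.2 pN
    have sS := Real.sqrt_pos.2 pS
    have sR := Real.sqrt_pos.2 (pR 0)
    have sR2 := Real.sq_sqrt (pR 0).le
    rw [div_eq_iff (mul_pos sN sR).ne'] at hNR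
    rw [div_eq_iff (mul_pos sS sR).ne'] at hSR
    rw [div_eq_iff (mul_pos sN sS).ne'] at hc
    have hprod : (inner ℝ (g north) (g (rim k 0)) - 1) * (inner ℝ (g south) (g (rim k 0)) - 1) =
        √(inner ℝ (g north) (g north) - 1) * √(inner ℝ (g south) (g south) - 1) *
          (inner ℝ (g (rim k 0)) (g (rim k 0)) - 1) := by
      rw [hNR, hSR]
      linear_combination √(inner ℝ (g north) (g north) - 1) *
        √(inner ℝ (g south) (g south) - 1) * sR2
    have hprod0 : (inner ℝ (g north) (g (rim k 0)) - 1) *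
        (inner ℝ (g south) (g (rim k 0)) - 1) ≠ (0 : ℝ) := by
      rw [hprod]
      exact (mul_pos (mul_pos sN sS) (pR 0)).ne'
    have hceq : c = -((inner ℝ (g north) (g south) - 1) *
        (inner ℝ (g (rim k 0)) (g (rim k 0)) - 1)) /
        ((inner ℝ (g north) (g (rim k 0)) - 1) * (inner ℝ (g south) (g (rim k 0)) - 1)) := by
      rw [eq_div_iff hprod0, hprod]
      linear_combination (inner ℝ (g (rim k 0)) (g (rim k 0)) - 1) * hc
    have hmem : ∀ x ∈ Set.extremePoints ℝ (convexHull ℝ S),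
        ∀ y ∈ Set.extremePoints ℝ (convexHull ℝ S), inner ℝ x y - 1 ∈ K := fun x hx y hy =>
      sub_mem (inner_mem_coordinateField hx hy) (one_mem K)
    rw [hceq]
    exact div_mem (neg_mem (mul_mem (hmem _ mN _ mS) (hmem _ mR _ mR)))
      (mul_mem (hmem _ mN _ mR) (hmem _ mS _ mR))
  have htK : (6 - 2 * c) / (1 + c) ∈ K :=
    div_mem (sub_mem (ofNat_mem K 6) (mul_mem (ofNat_mem K 2) hcK)) (add_mem (one_mem K) hcK)
  exact totient_le_two_mul_finrank K hk0 hζ (t := ⟨_, htK⟩) hsum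

theorem koebeDegree_of_combinatoriallyEquivalent_bipyramid {k : ℕ} (hk : 3 ≤ k) {P : Set E3}
    (hP : CombinatoriallyEquivalent P (bipyramid k)) :
    ∃ d : ℕ, koebeDegree P = d ∧ (Nat.totient k : ℝ) / 2 ≤ d := by
  obtain ⟨Q, hQ, hfin⟩ := exists_isKoebeRealization_bipyramid hk
  have hQP : IsKoebeRealization P Q := ⟨hQ.1, hQ.2.1.trans hP.symm, hQ.2.2⟩
  have hle : koebeDegree P ≤ realizationDegree Q := iInf₂_le Q hQP
  have hne : koebeDegree P ≠ ⊤ := by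
    refine ne_top_of_le_ne_top ?_ hle
    rw [realizationDegree, ← Module.finrank_eq_rank, Cardinal.toENat_nat]
    exact ENat.natCast_ne_top _
  obtain ⟨d, hd⟩ := ENat.ne_top_iff_exists.1 hne
  refine ⟨d, hd.symm, ?_⟩
  -- Natural division of φ(k) + 1 by 2 is φ(k)/2 rounded up, so nothing is lost for odd values.
  have hlow : (((Nat.totient k + 1) / 2 : ℕ) : ℕ∞) ≤ koebeDegree P := by
    refine le_iInf₂ fun R hR => natCast_le_realizationDegree fun hRfin => ?_
    have := totient_le_of_isKoebeRealization hk
      (⟨hR.1, hR.2.1.trans hP, hR.2.2⟩ : IsKoebeRealization (bipyramid k) R)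
    omega
  rw [← hd] at hlow
  have h1 : (Nat.totient k + 1) / 2 ≤ d := by exact_mod_cast hlow
  have h2 : Nat.totient k ≤ 2 * d := by omega
  have h3 : (Nat.totient k : ℝ) ≤ 2 * d := by exact_mod_cast h2
  linarith

theorem theorem3p18 :
    (∀ k : ℕ, 4 ≤ k → ∀ P : Set E3, IsThreePolytope P →
      CombinatoriallyEquivalent P (bipyramid k) →
        ∃ d : ℕ, koebeDegree P = d ∧ (Nat.totient k : ℝ) / 4 ≤ d) ∧
    (∀ C : ℕ, ∃ P : Set E3, IsThreePolytope P ∧ ∃ d : ℕ, koebeDegree P = d ∧ C < d) := by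
  constructor
  · intro k hk P _ hP
    obtain ⟨d, hd, h⟩ := koebeDegree_of_combinatoriallyEquivalent_bipyramid (by omega) hP
    refine ⟨d, hd, le_trans ?_ h⟩
    have : (0 : ℝ) ≤ Nat.totient k := by positivity
    linarith
  · intro C
    -- For a prime p ≥ 2C + 4 the degree is at least (p - 1)/2 > C.
    obtain ⟨p, hp, hprime⟩ := Nat.exists_infinite_primes (2 * C + 4)
    obtain ⟨d, hd, h⟩ := koebeDegree_of_combinatoriallyEquivalent_bipyramid (k := p) (by omega)
      (⟨OrderIso.refl _⟩ : CombinatoriallyEquivalent (bipyramid p) (bipyramid p))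
    refine ⟨bipyramid p, isThreePolytope_bipyramid (by omega), d, hd, ?_⟩
    rw [div_le_iff₀ two_pos, Nat.totient_prime hprime] at h
    have h' : p - 1 ≤ d * 2 := by exact_mod_cast h
    omega
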